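/- Conventions. A \emph{ray} in a graph $G$ is a one-sided infinite path. Two rays are in the same \emph{end} if for every finite $S\subseteq V(G)$ they have tails in the same component of $G-S$; an end is an equivalence class of rays. A \emph{separation} of $G$ is a pair $(A,B)$ of vertex sets with $A\cup B=V(G)$ and no edge between $A\setminus B$ and $B\setminus A$; its \emph{order} is $|A\cap B|$. If $|A\cap B|$ is finite, an end \emph{lies in} $B$ if each of its rays has all but finitely many vertices in $B$. A vertex $v$ \emph{dominates} an end $\omega$ if there is no separation $(A,B)$ of finite order with $v\in A\setminus B$ and $\omega$ lying in $B$; $\omega$ is \emph{undominated} if no vertex dominates it. The \emph{vertex degree} of $\omega$ is the maximal cardinality of a family of pairwise disjoint rays belonging to $\omega$. If $\omega$ has vertex degree $k\in\mathbb N$, a separation $(A,B)$ is \emph{$\omega$-relevant} if its order is exactly $k$, $A\setminus B$ is connected, every vertex in $A\cap B$ has a neighbour in $A\setminus B$, $\omega$ lies in $B$, and there is no separation $(C,D)$ of order less than $k$ such that $A\subseteq C$ and $\omega$ lies in $D$. Separations $(A,B)$ and $(C,D)$ are \emph{nested} if one of the following holds: $A\subseteq C$ and $D\subseteq B$; $A\subseteq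 D$ and $C\subseteq B$; $B\subseteq C$ and $D\subseteq A$; $B\subseteq D$ and $C\subseteq A$. A set of separations is \emph{nested} if any two separations in it are nested. An automorphism $\varphi$ of $G$ acts on separations by $\varphi(A,B)=(\varphi(A),\varphi(B))$. Theorem. Let $G$ be a connected graph with exactly one end $\omega$, and suppose that $\omega$ is undominated and has finite vertex degree $k$. Then there is a nested set $\mathcal S$ of $\omega$-relevant separations of $G$ that is invariant under $\mathrm{Aut}(G)$. Moreover, there are a tree $T$ with exactly one end and a bijection $f$ from $\mathcal S$ to the edge set of $T$ such that the natural action of $\mathrm{Aut}(G)$ on $\mathcal S$ induces an action on $T$ by automorphisms, that is, there is a group homomorphism $\rho:\mathrm{Aut}(G)\to\mathrm{Aut}(T)$ with $f(\varphi(s))=\rho(\varphi)(f(s))$ for all $\varphi\in\mathrm{Aut}(G)$ and $s\in\mathcal S$. -/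

import Mathlib

universe u

namespace SimpleGraph

variable {V : Type u} {G : SimpleGraph V}

/-- A ray: a one-sided infinite path. -/
structure Ray (G : SimpleGraph V) where
  vert : ℕ → V
  injective : Function.Injective vert
  adj : ∀ n, G.Adj (vert n) (vert (n + 1))

/-- The set of vertices of a ray. -/
def Ray.verts (R : G.Ray) : Set V := Set.range R.vert

/-- All but finitely many vertices of the ray `R` are in `A`. -/
def Ray.LiesIn (R : G.Ray) (A : Set V) : Prop :=
  ∀ᶠ n in Filter.atTop, R.vert n ∈ A

/-- Two rays belong to the same end if, for every finite set `S` of vertices, they lie in the same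
component of `G - S`. (If `G - S` is connected, this condition holds trivially.) -/
def Ray.SameEnd (R R' : G.Ray) : Prop :=
  ∀ S : Set V, S.Finite → ∃ C : G.ComponentCompl S, R.LiesIn (C : Set V) ∧ R'.LiesIn (C : Set V)

theorem Ray.exists_liesIn (R : G.Ray) {S : Set V} (hS : S.Finite) :
    ∃ C : G.ComponentCompl S, R.LiesIn (C : Set V) := by
  have h1 : ∀ᶠ n in Filter.atTop, R.vert n ∉ S := by
    rw [← Nat.cofinite_eq_atTop]
    exact (hS.preimage R.injective.injOn).compl_mem_cofinite
  obtain ⟨N, hN⟩ := Filter.eventually_atTop.1 h1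
  refine ⟨G.componentComplMk (hN N le_rfl), Filter.eventually_atTop.2 ⟨N, fun n hn => ?_⟩⟩
  induction n, hn using Nat.le_induction with
  | base => exact G.componentComplMk_mem _
  | succ n hn ih =>
    exact ComponentCompl.mem_of_adj _ _ ih (hN (n + 1) (by omega)) (R.adj n)

theorem Ray.sameEnd_equivalence (G : SimpleGraph V) :
    Equivalence (Ray.SameEnd : G.Ray → G.Ray → Prop) where
  refl R S hS := by
    obtain ⟨C, hC⟩ := R.exists_liesIn hS
    exact ⟨C, hC, hC⟩
  symm h S hS := by
    obtain ⟨C, h1, h2⟩ := h S hS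
    exact ⟨C, h2, h1⟩
  trans h h' S hS := by
    obtain ⟨C, h1, h2⟩ := h S hS
    obtain ⟨D, h3, h4⟩ := h' S hS
    obtain ⟨n, hn, hn'⟩ := (h2.and h3).exists
    have : C = D := by
      by_contra hne
      exact Set.disjoint_left.1 (ComponentCompl.pairwise_disjoint hne) hn hn'
    subst this
    exact ⟨C, h1, h4⟩

/-- The equivalence relation on rays whose classes are the ends. -/
def raySetoid (G : SimpleGraph V) : Setoid G.Ray := ⟨Ray.SameEnd, Ray.sameEnd_equivalence G⟩

/-- The (vertex) ends of `G`: the equivalence classes of rays. -/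
def RayEnd (G : SimpleGraph V) : Type u := Quotient G.raySetoid

/-- The end to which a ray belongs. -/
def Ray.toEnd (R : G.Ray) : G.RayEnd := Quotient.mk G.raySetoid R

/-- `G` has exactly one end. -/
def IsOneEnded (G : SimpleGraph V) : Prop := ∃ ω : G.RayEnd, ∀ η : G.RayEnd, η = ω

/-- The end `ω` lies in the vertex set `A`, here a side of a separation of finite order: every ray
in `ω` lies in `A`. -/
def RayEnd.LiesIn (ω : G.RayEnd) (A : Set V) : Prop :=
  ∀ R : G.Ray, R.toEnd = ω → R.LiesIn A

/-- The vertex degree of an end: the supremum, in `ℕ ∪ {∞}`, of the sizes of the finite families of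
pairwise disjoint rays belonging to the end. -/
noncomputable def RayEnd.vertexDegree (ω : G.RayEnd) : ℕ∞ :=
  sSup {d : ℕ∞ | ∃ (m : ℕ) (R : Fin m → G.Ray), d = m ∧ (∀ i, (R i).toEnd = ω) ∧
    Pairwise fun i j => Disjoint (R i).verts (R j).verts}

/-- The pair `s = (A, B)` is a separation of `G`. -/
def IsSeparation (G : SimpleGraph V) (s : Set V × Set V) : Prop :=
  s.1 ∪ s.2 = Set.univ ∧ ∀ a ∈ s.1 \ s.2, ∀ b ∈ s.2 \ s.1, ¬ G.Adj a b

/-- The order of a separation `(A, B)`: the number of vertices in `A ∩ B`. -/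
noncomputable def sepOrder (s : Set V × Set V) : ℕ∞ := (s.1 ∩ s.2).encard

/-- The vertex `v` dominates the end `ω`. -/
def Dominates (v : V) (ω : G.RayEnd) : Prop :=
  ¬ ∃ s : Set V × Set V, G.IsSeparation s ∧ (s.1 ∩ s.2).Finite ∧ v ∈ s.1 \ s.2 ∧ ω.LiesIn s.2

/-- Strong nestedness of separations (which is also the partial order on separations). -/
def StronglyNested (s t : Set V × Set V) : Prop := s.1 ⊆ t.1 ∧ t.2 ⊆ s.2

/-- Two separations are nested if they are strongly nested after possibly exchanging the sides of
one or both of them. -/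
def SepNested (s t : Set V × Set V) : Prop :=
  StronglyNested s t ∨ StronglyNested s t.swap ∨
    StronglyNested s.swap t ∨ StronglyNested s.swap t.swap

/-- A separation `s = (A, B)` is `ω`-relevant, for an end `ω` of finite vertex degree. -/
structure IsRelevant (ω : G.RayEnd) (s : Set V × Set V) : Prop where
  isSeparation : G.IsSeparation s
  order_eq : sepOrder s = ω.vertexDegree
  connected : (G.induce (s.1 \ s.2)).Connected
  exists_adj : ∀ v ∈ s.1 ∩ s.2, ∃ w ∈ s.1 \ s.2, G.Adj v w
  liesIn : ω.LiesIn s.2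
  not_exists : ¬ ∃ t : Set V × Set V, G.IsSeparation t ∧ sepOrder t < ω.vertexDegree ∧
    s.1 ⊆ t.1 ∧ ω.LiesIn t.2

/-- The natural action of an automorphism of `G` on pairs of vertex sets. -/
def sepMap (φ : G ≃g G) (s : Set V × Set V) : Set V × Set V := (φ '' s.1, φ '' s.2)

end SimpleGraph

/-!
As `G` has only one end `ω`, a set lies on the side of the end if it contains a tail of every ray
(`Carries`), and an automorphism moves rays to rays, so that all notions below are invariant.

*Linked sets.* A set is `Linked k` if fewer than `k` vertices never separate it from the end. Since
no vertex dominates `ω`, a vertex of a linked family can always be replaced by a neighbour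
(`exists_adj_linked`), and iterating this turns a linked family into disjoint rays. Hence a maximal
linked family has exactly `k` members, and every finite set is separated from `ω` by at most `k`
vertices (`thinEnd_of_end`).

*Regions.* A `Region` is a connected set `K` with `k` boundary vertices, off the end, whose closure
is linked; `(clos K, Kᶜ)` is then relevant. By submodularity of the order of separations, the union
of two touching regions is a region if the intersection of their closures is linked
(`Region.union`), and every finite set lies in a region. The boundary of a region is a minimal
separator, and there are only finitely many minimal separators of size `k` between two vertices.
It follows that a region crosses only finitely many others (`Region.finite_cross`) and that there
are only finitely many regions between two given ones. There is no infinite descending sequence of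
regions, as it would produce a ray inside a region (`ThinEnd.not_descending`). In particular no
automorphism maps a region properly into itself, and finitely many automorphisms fix a common
region (`Region.exists_fixed`).

*An invariant nested family.* Zorn's lemma gives a maximal invariant nested family `S` of `Deep`
regions, where a region is deep if it contains some region and all regions crossing that one. Such a
family has members above every region, because it could otherwise be extended by the orbit of a new
region (`exists_deep_nested_orbit`). This region is obtained as follows. First find a region `N`
that is nested with `S`. Unions of translates of `N` that are regions above `N` are bounded, by a region
fixed by the finitely many automorphisms needed, so there is a maximal one, `M`. If a translate of
`M` still crosses `M`, then the closures of the two do not have a linked intersection. By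
submodularity at the other pair of corners, cutting all these translates off `M` does not increase
the order. The result is a region with a nested orbit.

*The tree.* Ordered by inclusion, `S` is a directed poset with finite intervals in which the upper
bounds of an element form a chain. So each element has a least element above it, its parent, and
joining every element to its parent gives a tree, whose edges correspond to the elements of `S`.
As there are no infinite descending sequences, every ray of the tree follows the parent map, and any
two such rays meet, so the tree has exactly one end.
-/

namespace SimpleGraph

variable {V : Type u} {G : SimpleGraph V}

/-! ### Connected vertex sets, boundaries and components -/

/-- `bdry K` is the outer vertex boundary of `K`: the vertices outside `K` with a neighbour
in `K`. -/
def bdry (G : SimpleGraph V) (K : Set V) : Set V := {v | v ∉ K ∧ ∃ u ∈ K, G.Adj u v}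

/-- `clos K` is `K` together with its boundary. -/
def clos (G : SimpleGraph V) (K : Set V) : Set V := K ∪ G.bdry K

/-- A vertex set is connected if it is nonempty and is the only nonempty subset of itself that is
closed under passing to neighbours inside the set. This is equivalent to connectedness of the
induced subgraph, see `IsConn.induce_connected`. -/
def IsConn (G : SimpleGraph V) (K : Set V) : Prop :=
  K.Nonempty ∧ ∀ P ⊆ K, P.Nonempty → (∀ a ∈ P, ∀ b ∈ K, G.Adj a b → b ∈ P) → P = K

/-- `ReachIn Z x y`: there is a walk from `x` to `y` all of whose vertices, except possibly the
first, lie in `Z`. -/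
def ReachIn (G : SimpleGraph V) (Z : Set V) : V → V → Prop :=
  Relation.ReflTransGen fun a b => G.Adj a b ∧ b ∈ Z

/-- The set of vertices reachable from `x` inside `Z`. For `x ∈ Z` this is the component of `x` in
the subgraph induced on `Z`. -/
def compIn (G : SimpleGraph V) (Z : Set V) (x : V) : Set V := {y | G.ReachIn Z x y}

theorem subset_clos (K : Set V) : K ⊆ G.clos K := Set.subset_union_left

theorem bdry_subset_clos (K : Set V) : G.bdry K ⊆ G.clos K := Set.subset_union_right

theorem mem_clos_of_adj {K : Set V} {a b : V} (ha : a ∈ K) (h : G.Adj a b) : b ∈ G.clos K := by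
  by_cases hb : b ∈ K
  · exact Or.inl hb
  · exact Or.inr ⟨hb, a, ha, h⟩

theorem clos_mono {K L : Set V} (h : K ⊆ L) : G.clos K ⊆ G.clos L := by
  rintro v (hv | ⟨_, u, hu, huv⟩)
  · exact Or.inl (h hv)
  · exact mem_clos_of_adj (h hu) huv

theorem clos_inter_compl (K : Set V) : G.clos K ∩ Kᶜ = G.bdry K := by
  ext v
  constructor
  · rintro ⟨h | h, h'⟩
    · exact absurd h h'
    · exact h
  · exact fun h => ⟨Or.inr h, h.1⟩

theorem clos_union (K L : Set V) : G.clos (K ∪ L) = G.clos K ∪ G.clos L := by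
  apply Set.Subset.antisymm
  · rintro v ((hv | hv) | ⟨_, u, hu | hu, huv⟩)
    · exact Or.inl (Or.inl hv)
    · exact Or.inr (Or.inl hv)
    · exact Or.inl (mem_clos_of_adj hu huv)
    · exact Or.inr (mem_clos_of_adj hu huv)
  · exact Set.union_subset (clos_mono Set.subset_union_left) (clos_mono Set.subset_union_right)

/-- A connected set meeting `N` but not the boundary of `N` is contained in `N`. -/
theorem IsConn.subset_of_disjoint_bdry {K N : Set V} (hK : G.IsConn K) (h1 : (K ∩ N).Nonempty)
    (h2 : K ∩ G.bdry N = ∅) : K ⊆ N := by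
  have := hK.2 (K ∩ N) Set.inter_subset_left h1 (by
    rintro a ⟨_, haN⟩ b hb hab
    refine ⟨hb, ?_⟩
    by_contra hbN
    exact Set.eq_empty_iff_forall_notMem.1 h2 b ⟨hb, hbN, a, haN, hab⟩)
  exact fun x hx => (this.symm ▸ hx : x ∈ K ∩ N).2

theorem IsConn.union {M N : Set V} (hM : G.IsConn M) (hN : G.IsConn N)
    (h : (M ∩ G.clos N).Nonempty) : G.IsConn (M ∪ N) := by
  refine ⟨hM.1.mono Set.subset_union_left, fun P hP hne hcl => ?_⟩
  have key : ∀ K, G.IsConn K → K ⊆ M ∪ N → (P ∩ K).Nonempty → K ⊆ P := by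
    intro K hK hKs hPK
    have := hK.2 (P ∩ K) Set.inter_subset_right hPK (by
      rintro a ⟨haP, _⟩ b hb hab
      exact ⟨hcl a haP b (hKs hb) hab, hb⟩)
    exact fun x hx => (this.symm ▸ hx : x ∈ P ∩ K).1
  have kM := key M hM Set.subset_union_left
  have kN := key N hN Set.subset_union_right
  -- `M` and `N` touch, so that `P` meets one of them as soon as it contains the other.
  obtain ⟨v, hvM, hv⟩ := h
  have hMN : M ⊆ P → N ⊆ P := by
    intro hMP
    rcases hv with hv | ⟨_, u, hu, huv⟩
    · exact kN ⟨v, hMP hvM, hv⟩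
    · exact kN ⟨u, hcl v (hMP hvM) u (Or.inr hu) huv.symm, hu⟩
  have hNM : N ⊆ P → M ⊆ P := by
    intro hNP
    rcases hv with hv | ⟨_, u, hu, huv⟩
    · exact kM ⟨v, hNP hv, hvM⟩
    · exact kM ⟨v, hcl u (hNP hu) v (Or.inl hvM) huv, hvM⟩
  apply hP.antisymm
  obtain ⟨x, hx⟩ := hne
  rcases hP hx with hxM | hxN
  · have := kM ⟨x, hx, hxM⟩
    exact Set.union_subset this (hMN this)
  · have := kN ⟨x, hx, hxN⟩
    exact Set.union_subset (hNM this) this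

theorem IsConn.induce_connected {K : Set V} (hK : G.IsConn K) : (G.induce K).Connected := by
  have : Nonempty K := hK.1.to_subtype
  refine ⟨fun x y => ?_⟩
  have := hK.2 {v | ∃ h : v ∈ K, (G.induce K).Reachable x ⟨v, h⟩} (fun v hv => hv.1)
    ⟨x, x.2, Reachable.refl _⟩ (by
      rintro a ⟨ha, har⟩ b hb hab
      exact ⟨hb, har.trans (Adj.reachable (by simpa using hab))⟩)
  exact (this.symm.subset y.2).2

theorem ReachIn.mono {Z Z' : Set V} (h : Z ⊆ Z') {x y : V} (hxy : G.ReachIn Z x y) :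
    G.ReachIn Z' x y :=
  Relation.ReflTransGen.mono (fun _ _ h' => ⟨h'.1, h h'.2⟩) _ _ hxy

theorem ReachIn.mem {Z : Set V} {x y : V} (hx : x ∈ Z) (h : G.ReachIn Z x y) : y ∈ Z := by
  induction h with
  | refl => exact hx
  | tail _ h _ => exact h.2

theorem self_mem_compIn (Z : Set V) (x : V) : x ∈ G.compIn Z x := Relation.ReflTransGen.refl

theorem compIn_subset {Z : Set V} {x : V} (hx : x ∈ Z) : G.compIn Z x ⊆ Z :=
  fun _ hy => ReachIn.mem hx hy

theorem isConn_compIn (Z : Set V) (x : V) : G.IsConn (G.compIn Z x) := by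
  refine ⟨⟨x, self_mem_compIn Z x⟩, fun P hP hne hcl => ?_⟩
  have hxP : x ∈ P := by
    -- The complement of `P` in the component is closed under adjacency as well.
    by_contra hxP
    obtain ⟨y, hy⟩ := hne
    have : ∀ z, G.ReachIn Z x z → z ∉ P := by
      intro z hz
      induction hz with
      | refl => exact hxP
      | tail hab hbc ih => exact fun hc => ih (hcl _ hc _ hab hbc.1.symm)
    exact this y (hP hy) hy
  apply hP.antisymm
  intro y hy
  induction hy with
  | refl => exact hxP
  | tail hab hbc ih => exact hcl _ ih _ (Relation.ReflTransGen.tail hab hbc) hbc.1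

theorem disjoint_bdry_compIn (Z : Set V) (x : V) : G.bdry (G.compIn Z x) ∩ Z = ∅ := by
  rw [Set.eq_empty_iff_forall_notMem]
  rintro v ⟨⟨hv, u, hu, huv⟩, hvZ⟩
  exact hv (Relation.ReflTransGen.tail hu ⟨huv, hvZ⟩)

theorem IsConn.subset_compIn {K Z : Set V} {x : V} (hK : G.IsConn K) (hKZ : K ⊆ Z) (hx : x ∈ K) :
    K ⊆ G.compIn Z x := by
  apply hK.subset_of_disjoint_bdry ⟨x, hx, self_mem_compIn Z x⟩
  rw [Set.eq_empty_iff_forall_notMem]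
  rintro v ⟨hvK, hv⟩
  exact Set.eq_empty_iff_forall_notMem.1 (disjoint_bdry_compIn Z x) v ⟨hv, hKZ hvK⟩

theorem IsConn.reachIn {K : Set V} (hK : G.IsConn K) {x y : V} (hx : x ∈ K) (hy : y ∈ K) :
    G.ReachIn K x y := hK.subset_compIn subset_rfl hx hy

theorem isConn_singleton (x : V) : G.IsConn {x} := by
  refine ⟨⟨x, rfl⟩, fun P hP hne _ => ?_⟩
  exact (Set.Nonempty.subset_singleton_iff hne).1 hP

/-- A walk only visits finitely many vertices. -/
theorem ReachIn.exists_finite {Z : Set V} {x y : V} (h : G.ReachIn Z x y) :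
    ∃ P ⊆ Z, P.Finite ∧ G.ReachIn P x y ∧ G.IsConn (insert x P) := by
  induction h with
  | refl => exact ⟨∅, by simp, by simp, Relation.ReflTransGen.refl, by
      simpa using isConn_singleton x⟩
  | @tail b c hab hbc ih =>
    obtain ⟨P, hPZ, hPf, hP, hc⟩ := ih
    refine ⟨insert c P, Set.insert_subset hbc.2 hPZ, hPf.insert c,
      Relation.ReflTransGen.tail (hP.mono (Set.subset_insert _ _)) ⟨hbc.1, Set.mem_insert _ _⟩, ?_⟩
    have hb : b ∈ insert x P := by
      refine ReachIn.mem (Set.mem_insert _ _) (hP.mono (Set.subset_insert x P))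
    have := (isConn_singleton c).union hc ⟨c, rfl, mem_clos_of_adj hb hbc.1⟩
    rwa [Set.singleton_union, Set.insert_comm] at this

theorem exists_finite_isConn (hG : G.Connected) {X : Set V} (hX : X.Finite) (hne : X.Nonempty) :
    ∃ Y, X ⊆ Y ∧ Y.Finite ∧ G.IsConn Y := by
  obtain ⟨x, hx⟩ := hne
  have hreach : ∀ y, G.ReachIn Set.univ x y := by
    intro y
    obtain ⟨p⟩ := hG.preconnected x y
    clear hx
    induction p with
    | nil => exact Relation.ReflTransGen.refl
    | cons h p ih => exact Relation.ReflTransGen.head ⟨h, trivial⟩ ih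
  suffices ∃ Y, insert x X ⊆ Y ∧ Y.Finite ∧ G.IsConn Y by
    obtain ⟨Y, h1, h2⟩ := this
    exact ⟨Y, (Set.subset_insert _ _).trans h1, h2⟩
  clear hx
  induction X, hX using Set.Finite.induction_on with
  | empty => exact ⟨{x}, by simp, Set.finite_singleton x, isConn_singleton x⟩
  | @insert a X _ _ ih =>
    obtain ⟨Y, hXY, hYf, hY⟩ := ih
    obtain ⟨P, -, hPf, hP, hPc⟩ := (hreach a).exists_finite
    refine ⟨Y ∪ insert x P, ?_, hYf.union (hPf.insert x), hY.union hPc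
      ⟨x, hXY (Set.mem_insert _ _), Or.inl (Set.mem_insert _ _)⟩⟩
    have ha : a ∈ insert x P :=
      ReachIn.mem (Set.mem_insert _ _) (hP.mono (Set.subset_insert x P))
    rw [Set.insert_comm]
    exact Set.insert_subset (Or.inr ha) (hXY.trans Set.subset_union_left)

/-- A walk from `y` to `z ≠ y` can be shortened so that it does not return to `y`. -/
theorem ReachIn.exists_first_step {U : Set V} {y z : V} (h : G.ReachIn Uᶜ y z) (hne : y ≠ z) :
    ∃ y', G.Adj y y' ∧ y' ∉ insert y U ∧ G.ReachIn (insert y U)ᶜ y' z := by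
  induction h with
  | refl => exact absurd rfl hne
  | @tail b c hab hbc ih =>
    have hc : c ∉ insert y U := by
      rintro (h | h)
      · exact hne h.symm
      · exact hbc.2 h
    by_cases hb : y = b
    · subst hb
      exact ⟨c, hbc.1, hc, Relation.ReflTransGen.refl⟩
    · obtain ⟨y', h1, h2, h3⟩ := ih hb
      exact ⟨y', h1, h2, Relation.ReflTransGen.tail h3 ⟨hbc.1, hc⟩⟩

/-- A walk that enters `K` from outside passes through the boundary of `K`. -/
theorem ReachIn.exists_mem_bdry {Z K : Set V} {y z : V} (h : G.ReachIn Z y z) (hy : y ∉ K)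
    (hz : z ∈ K) : ∃ s ∈ G.bdry K, G.ReachIn Z y s ∧ G.ReachIn Z s z := by
  induction h using Relation.ReflTransGen.head_induction_on with
  | refl => exact absurd hz hy
  | @head a b hab hbc ih =>
    by_cases hb : b ∈ K
    · exact ⟨a, ⟨hy, b, hb, hab.1.symm⟩, Relation.ReflTransGen.refl,
        Relation.ReflTransGen.head hab hbc⟩
    · obtain ⟨s, hs, h1, h2⟩ := ih hb
      exact ⟨s, hs, Relation.ReflTransGen.head hab h1, h2⟩

/-! ### Separations of finite order and the end -/

/-- Every ray of `G` lies in `B`. In a one-ended graph this says that the end lies in `B`. -/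
def Carries (G : SimpleGraph V) (B : Set V) : Prop := ∀ R : G.Ray, R.LiesIn B

/-- `(A, B)` is a separation of finite order. -/
structure FinSep (G : SimpleGraph V) (A B : Set V) : Prop where
  cover : ∀ v, v ∈ A ∨ v ∈ B
  no_adj : ∀ a ∈ A, ∀ b ∈ B, a ∉ B → b ∉ A → ¬ G.Adj a b
  finite : (A ∩ B).Finite

/-- `(A, B)` is a separation of finite order and every ray lies in `B`. -/
structure EndSep (G : SimpleGraph V) (A B : Set V) : Prop extends FinSep G A B where
  carries : G.Carries B

theorem Carries.mono {B C : Set V} (h : G.Carries B) (hBC : B ⊆ C) : G.Carries C :=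
  fun R => (h R).mono fun _ hn => hBC hn

theorem Carries.inter {B C : Set V} (h : G.Carries B) (h' : G.Carries C) : G.Carries (B ∩ C) :=
  fun R => (h R).and (h' R)

theorem Carries.compl_of_finite {S : Set V} (hS : S.Finite) : G.Carries Sᶜ := by
  intro R
  have := (hS.preimage R.injective.injOn).compl_mem_cofinite
  rw [Nat.cofinite_eq_atTop] at this
  exact this

theorem FinSep.symm {A B : Set V} (h : G.FinSep A B) : G.FinSep B A :=
  ⟨fun v => (h.cover v).symm, fun a ha b hb h1 h2 h3 => h.no_adj b hb a ha h2 h1 h3.symm,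
    by rw [Set.inter_comm]; exact h.finite⟩

theorem FinSep.union {A B C D : Set V} (h : G.FinSep A B) (h' : G.FinSep C D) :
    G.FinSep (A ∪ C) (B ∩ D) := by
  refine ⟨fun v => ?_, fun a ha b hb h1 h2 h3 => ?_, ?_⟩
  · have := h.cover v
    have := h'.cover v
    simp only [Set.mem_union, Set.mem_inter_iff]
    tauto
  · have hb2 : b ∉ A ∧ b ∉ C := by simpa [not_or] using h2
    rcases h.cover a with haA | haB
    · by_cases haB : a ∈ B
      · have haD : a ∉ D := fun hD => h1 ⟨haB, hD⟩
        exact h'.no_adj a ((h'.cover a).resolve_right haD) b hb.2 haD hb2.2 h3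
      · exact h.no_adj a haA b hb.1 haB hb2.1 h3
    · have haD : a ∉ D := fun hD => h1 ⟨haB, hD⟩
      exact h'.no_adj a ((h'.cover a).resolve_right haD) b hb.2 haD hb2.2 h3
  · refine (h.finite.union h'.finite).subset ?_
    rintro v ⟨hv | hv, hB, hD⟩
    · exact Or.inl ⟨hv, hB⟩
    · exact Or.inr ⟨hv, hD⟩

theorem FinSep.inter {A B C D : Set V} (h : G.FinSep A B) (h' : G.FinSep C D) :
    G.FinSep (A ∩ C) (B ∪ D) := (h.symm.union h'.symm).symm

theorem EndSep.union {A B C D : Set V} (h : G.EndSep A B) (h' : G.EndSep C D) :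
    G.EndSep (A ∪ C) (B ∩ D) :=
  ⟨h.toFinSep.union h'.toFinSep, h.carries.inter h'.carries⟩

theorem EndSep.inter {A B C D : Set V} (h : G.EndSep A B) (h' : G.FinSep C D) :
    G.EndSep (A ∩ C) (B ∪ D) :=
  ⟨h.toFinSep.inter h', h.carries.mono Set.subset_union_left⟩

/-- The orders of opposite corners of two separations add up to the sum of their orders. -/
theorem FinSep.ncard_add_ncard {A B C D : Set V} (h : G.FinSep A B) (h' : G.FinSep C D) :
    ((A ∩ C) ∩ (B ∪ D)).ncard + ((A ∪ C) ∩ (B ∩ D)).ncard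
      = (A ∩ B).ncard + (C ∩ D).ncard := by
  rw [← Set.ncard_union_add_ncard_inter _ _ (h.inter h').finite (h.union h').finite,
    ← Set.ncard_union_add_ncard_inter _ _ h.finite h'.finite]
  congr 2
  · ext v
    have := h.cover v
    have := h'.cover v
    simp only [Set.mem_union, Set.mem_inter_iff]
    tauto
  · ext v
    simp only [Set.mem_union, Set.mem_inter_iff]
    tauto

theorem finSep_clos {K : Set V} (hf : (G.bdry K).Finite) : G.FinSep (G.clos K) Kᶜ := by
  refine ⟨fun v => ?_, fun a ha b _ h1 h2 h3 => ?_, by rwa [clos_inter_compl]⟩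
  · by_cases hv : v ∈ K
    · exact Or.inl (Or.inl hv)
    · exact Or.inr hv
  · exact h2 (mem_clos_of_adj (not_not.1 h1) h3)

/-- The vertex set `X` cannot be separated from the end by fewer than `k` vertices. -/
def Linked (G : SimpleGraph V) (k : ℕ) (X : Set V) : Prop :=
  ∀ A B, G.EndSep A B → X ⊆ A → k ≤ (A ∩ B).ncard

theorem Linked.mono {k : ℕ} {X Y : Set V} (h : G.Linked k X) (hXY : X ⊆ Y) : G.Linked k Y :=
  fun A B hAB hY => h A B hAB (hXY.trans hY)

/-- The vertices that separate `clos K` from the end can be pushed off `K`. -/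
theorem Linked.bdry {k : ℕ} {K : Set V} (h : G.Linked k (G.clos K)) (hK : G.Carries Kᶜ) :
    G.Linked k (G.bdry K) := by
  intro C D hCD hb
  refine (h (C ∪ K) (D \ K) ⟨⟨fun v => ?_, fun a ha b hb' h1 h2 h3 => ?_, ?_⟩, ?_⟩ ?_).trans ?_
  · have := hCD.cover v
    by_cases hv : v ∈ K
    · exact Or.inl (Or.inr hv)
    · exact this.imp Or.inl fun h => ⟨h, hv⟩
  · have hbC : b ∉ C := fun h => h2 (Or.inl h)
    by_cases haK : a ∈ K
    · exact hbC (hb ⟨hb'.2, a, haK, h3⟩)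
    · exact hCD.no_adj a (ha.resolve_right haK) b hb'.1 (fun h => h1 ⟨h, haK⟩) hbC h3
  · refine hCD.finite.subset ?_
    rintro v ⟨hv, hD, hvK⟩
    exact ⟨hv.resolve_right hvK, hD⟩
  · exact hCD.carries.inter hK
  · rintro v (hv | hv)
    · exact Or.inr hv
    · exact Or.inl (hb hv)
  · refine Set.ncard_le_ncard ?_ hCD.finite
    rintro v ⟨hv, hD, hvK⟩
    exact ⟨hv.resolve_right hvK, hD⟩

/-! ### Linked sets are starting points of disjoint rays -/

theorem exists_endSep_of_finite (hu : ∀ v, ∃ A B, G.EndSep A B ∧ v ∈ A \ B) {X : Set V}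
    (hX : X.Finite) : ∃ A B, G.EndSep A B ∧ X ⊆ A \ B := by
  induction X, hX using Set.Finite.induction_on with
  | empty =>
    exact ⟨∅, Set.univ, ⟨⟨by simp, by simp, by simp⟩, fun R => by simp [Ray.LiesIn]⟩, by simp⟩
  | @insert a X _ _ ih =>
    obtain ⟨A, B, h, hX⟩ := ih
    obtain ⟨C, D, h', ha⟩ := hu a
    refine ⟨A ∪ C, B ∩ D, h.union h', Set.insert_subset ⟨Or.inr ha.1, fun h => ha.2 h.2⟩ ?_⟩
    exact fun v hv => ⟨Or.inl (hX hv).1, fun h => (hX hv).2 h.1⟩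

theorem finite_and_ncard_le_of_finset {S : Set V} {c : ℕ}
    (h : ∀ F : Finset V, (F : Set V) ⊆ S → F.card ≤ c) : S.Finite ∧ S.ncard ≤ c := by
  have hf : S.Finite := by
    by_contra hinf
    obtain ⟨F, hF, hc⟩ := Set.Infinite.exists_subset_card_eq hinf (c + 1)
    have := h F hF
    omega
  refine ⟨hf, ?_⟩
  rw [Set.ncard_eq_toFinset_card S hf]
  exact h _ (by simp)

/-- A vertex `y` in a linked family can be replaced by one of its neighbours. The vertices of `U`
count as deleted from the graph. If no neighbour is suitable, then each neighbour is cut off by a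
separation of small order; these separations can be taken below a fixed finite separation, since
no vertex dominates the end, and their union shows that `y` was not linked. -/
theorem exists_adj_linked (hu : ∀ v, ∃ A B, G.EndSep A B ∧ v ∈ A \ B) {U Y : Set V}
    (hU : U.Finite) (hY : Y.Finite) {y : V} (hyU : y ∉ U) {c : ℕ} (hc : (U ∪ Y).ncard < c)
    (h : ∀ A B, G.EndSep A B → U ⊆ A ∩ B → insert y Y ⊆ A → c ≤ (A ∩ B).ncard) :
    ∃ z, G.Adj y z ∧ z ∉ insert y U ∧ z ∉ Y ∧
      ∀ A B, G.EndSep A B → insert y U ⊆ A ∩ B → insert z Y ⊆ A → c + 1 ≤ (A ∩ B).ncard := by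
  by_contra hcon
  push Not at hcon
  have hUY : (insert y U ∪ Y).Finite := (hU.insert y).union hY
  -- Among the separations with `U` and `y` in the separator and with `Y` and all neighbours of `y`
  -- on the small side, fix one, `(AF, BF)`, of least order. Such separations exist because no vertex
  -- dominates the end.
  have hex : ∃ t A B, G.EndSep A B ∧ insert y U ⊆ A ∩ B ∧ Y ⊆ A ∧ (∀ z, G.Adj y z → z ∈ A) ∧
      (A ∩ B).ncard = t := by
    obtain ⟨C, D, hCD, hW⟩ := exists_endSep_of_finite hu hUY
    have hUC : insert y U ⊆ C := fun v hv => (hW (Or.inl hv)).1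
    have hy := hW (Or.inl (Set.mem_insert y U))
    refine ⟨_, C, D ∪ insert y U, ⟨⟨fun v => ?_, fun a ha b hb h1 h2 h3 => ?_, ?_⟩, ?_⟩,
      fun v hv => ⟨hUC hv, Or.inr hv⟩, fun v hv => (hW (Or.inr hv)).1, fun z hz => ?_, rfl⟩
    · exact (hCD.cover v).imp id Or.inl
    · exact hCD.no_adj a ha b (hb.resolve_right fun h => h2 (hUC h)) (fun h => h1 (Or.inl h)) h2 h3
    · refine (hCD.finite.union (hU.insert y)).subset ?_
      rintro v ⟨hv, hv' | hv'⟩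
      · exact Or.inl ⟨hv, hv'⟩
      · exact Or.inr hv'
    · exact hCD.carries.mono Set.subset_union_left
    · by_contra hzC
      exact hCD.no_adj y hy.1 z ((hCD.cover z).resolve_left hzC) hy.2 hzC hz
  classical
  obtain ⟨AF, BF, hF, hUF, hYF, hNF, htF⟩ := Nat.find_spec hex
  have hmin := fun A B h1 h2 h3 h4 => Nat.find_min' hex ⟨A, B, h1, h2, h3, h4, rfl⟩
  rw [← htF] at hmin
  -- The separations of order at most `c` below `(AF, BF)` are closed under unions (as `y` and `Y`
  -- are linked, intersections have order at least `c`), and each neighbour of `y` is cut off by one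
  -- of them, by the choice of `(AF, BF)`.
  let Q : Set V → Set V → Prop := fun A B =>
    G.EndSep A B ∧ insert y U ⊆ A ∩ B ∧ Y ⊆ A ∧ (A ∩ B).ncard ≤ c ∧ A ⊆ AF ∧ BF ⊆ B
  have hQ0 : Q (insert y U ∪ Y) Set.univ := by
    refine ⟨⟨⟨by simp, by simp, by simpa using hUY⟩, fun R => by simp [Ray.LiesIn]⟩,
      by simp, by simp, ?_, ?_, by simp⟩
    · rw [Set.inter_univ, Set.insert_union]
      exact (Set.ncard_insert_le _ _).trans hc
    · exact Set.union_subset (hUF.trans Set.inter_subset_left) hYF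
  have hQz : ∀ z, G.Adj y z → ∃ A B, Q A B ∧ z ∈ A := by
    intro z hz
    by_cases h1 : z ∈ insert y U ∪ Y
    · exact ⟨_, _, hQ0, h1⟩
    obtain ⟨A, B, hAB, hUA, hzA, hlt⟩ := hcon z hz (fun h => h1 (Or.inl h)) (fun h => h1 (Or.inr h))
    have hYA : Y ⊆ A := (Set.subset_insert _ _).trans hzA
    refine ⟨A ∩ AF, B ∪ BF, ⟨hAB.inter hF.toFinSep, ?_, ?_, ?_, Set.inter_subset_right,
      Set.subset_union_right⟩, hzA (Set.mem_insert _ _), hNF z hz⟩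
    · exact fun v hv => ⟨⟨(hUA hv).1, (hUF hv).1⟩, Or.inl (hUA hv).2⟩
    · exact fun v hv => ⟨hYA hv, hYF hv⟩
    · have h2 := hmin (A ∪ AF) (B ∩ BF) (hAB.union hF)
        (fun v hv => ⟨Or.inl (hUA hv).1, (hUA hv).2, (hUF hv).2⟩)
        (fun v hv => Or.inl (hYA hv)) (fun w hw => Or.inr (hNF w hw))
      have h3 := hAB.toFinSep.ncard_add_ncard hF.toFinSep
      omega
  have hQu : ∀ A B C D, Q A B → Q C D → Q (A ∪ C) (B ∩ D) := by
    rintro A B C D ⟨h1, h2, h3, h4, h5, h6⟩ ⟨k1, k2, k3, k4, k5, k6⟩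
    refine ⟨h1.union k1, fun v hv => ⟨Or.inl (h2 hv).1, (h2 hv).2, (k2 hv).2⟩,
      fun v hv => Or.inl (h3 hv), ?_, Set.union_subset h5 k5, Set.subset_inter h6 k6⟩
    have := h _ _ (h1.inter k1.toFinSep)
      (fun v hv => ⟨⟨(h2 (Or.inr hv)).1, (k2 (Or.inr hv)).1⟩, Or.inl (h2 (Or.inr hv)).2⟩)
      (Set.insert_subset ⟨(h2 (Set.mem_insert _ _)).1, (k2 (Set.mem_insert _ _)).1⟩
        (fun v hv => ⟨h3 hv, k3 hv⟩))
    have h3 := h1.toFinSep.ncard_add_ncard k1.toFinSep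
    omega
  -- The union of all of them still has order at most `c`. It has all neighbours of `y` on its small
  -- side, so `y` can be dropped from the separator, which leaves fewer than `c` vertices.
  let A : Set V := {v | ∃ A B, Q A B ∧ v ∈ A}
  let B : Set V := {v | ∀ A B, Q A B → v ∈ B}
  have hfin : (A ∩ B).Finite ∧ (A ∩ B).ncard ≤ c := by
    apply finite_and_ncard_le_of_finset
    intro F hFAB
    have : ∃ A B, Q A B ∧ (F : Set V) ⊆ A := by
      have hFA : (F : Set V) ⊆ A := hFAB.trans Set.inter_subset_left
      clear hFAB
      induction F using Finset.induction_on with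
      | empty => exact ⟨_, _, hQ0, by simp⟩
      | insert a F _ ih =>
        rw [Finset.coe_insert] at hFA ⊢
        obtain ⟨A1, B1, h1, h2⟩ := ih ((Set.subset_insert _ _).trans hFA)
        obtain ⟨A2, B2, h3, h4⟩ := hFA (Set.mem_insert _ _)
        exact ⟨_, _, hQu _ _ _ _ h1 h3, Set.insert_subset (Or.inr h4)
          (h2.trans Set.subset_union_left)⟩
    obtain ⟨A1, B1, h1, h2⟩ := this
    rw [← Set.ncard_coe_finset]
    have hF1 : (F : Set V) ⊆ A1 ∩ B1 := fun v hv => ⟨h2 hv, (hFAB hv).2 _ _ h1⟩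
    exact (Set.ncard_le_ncard hF1 h1.1.finite).trans h1.2.2.2.1
  have hyA : y ∈ A := ⟨_, _, hQ0, Or.inl (Set.mem_insert _ _)⟩
  have hyB : y ∈ B := fun _ _ h => (h.2.1 (Set.mem_insert _ _)).2
  have hend : G.EndSep A (B \ {y}) := by
    refine ⟨⟨fun v => ?_, fun a ha b hb h1 h2 h3 => ?_, ?_⟩, ?_⟩
    · by_cases hv : v ∈ A
      · exact Or.inl hv
      · refine Or.inr ⟨fun A1 B1 h1 => ?_, fun h => hv (h ▸ hyA)⟩
        exact (h1.1.cover v).resolve_left fun h => hv ⟨_, _, h1, h⟩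
    · by_cases hay : a = y
      · subst hay
        exact h2 (hQz b h3)
      have haB : a ∉ B := fun h => h1 ⟨h, hay⟩
      obtain ⟨A1, B1, h4, h5⟩ : ∃ A1 B1, Q A1 B1 ∧ a ∉ B1 := by
        by_contra hne
        push Not at hne
        exact haB hne
      exact h4.1.no_adj a ((h4.1.cover a).resolve_right h5) b (hb.1 _ _ h4) h5
        (fun h => h2 ⟨_, _, h4, h⟩) h3
    · exact hfin.1.subset fun v hv => ⟨hv.1, hv.2.1⟩
    · have hBF : BF ⊆ B := fun v hv A1 B1 h1 => h1.2.2.2.2.2 hv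
      exact (hF.carries.mono hBF).inter (Carries.compl_of_finite (Set.finite_singleton y))
  have h1 := h A (B \ {y}) hend
    (fun v hv => ⟨⟨_, _, hQ0, Or.inl (Or.inr hv)⟩, fun _ _ h => (h.2.1 (Or.inr hv)).2,
      fun h => hyU (h ▸ hv)⟩)
    (Set.insert_subset hyA fun v hv => ⟨_, _, hQ0, Or.inr hv⟩)
  have h2 : A ∩ (B \ {y}) = (A ∩ B) \ {y} := by
    rw [Set.inter_sdiff_assoc]
  rw [h2] at h1
  have h3 := Set.ncard_sdiff_singleton_lt_of_mem (s := A ∩ B) ⟨hyA, hyB⟩ hfin.1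
  omega

/-- The invariant of the construction of disjoint rays: after deletion of `U`, the `m` distinct
vertices `y i` cannot be separated from the end by fewer than `m` vertices. -/
structure LinkedOff (G : SimpleGraph V) (U : Set V) {m : ℕ} (y : Fin m → V) : Prop where
  finite : U.Finite
  injective : Function.Injective y
  notMem : ∀ i, y i ∉ U
  le : ∀ A B, G.EndSep A B → U ⊆ A ∩ B → Set.range y ⊆ A → U.ncard + m ≤ (A ∩ B).ncard

theorem LinkedOff.step (hu : ∀ v, ∃ A B, G.EndSep A B ∧ v ∈ A \ B) {U : Set V} {m : ℕ}
    {y : Fin m → V} (h : G.LinkedOff U y) (i : Fin m) :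
    ∃ z, G.Adj (y i) z ∧ G.LinkedOff (insert (y i) U) (Function.update y i z) := by
  let Y : Set V := y '' {i}ᶜ
  have hY : Y.Finite := Set.toFinite _
  have hYc : Y.ncard + 1 = m := by
    rw [Set.ncard_image_of_injective _ h.injective, Set.ncard_compl]
    simp only [Set.ncard_singleton, Nat.card_eq_fintype_card, Fintype.card_fin]
    have := i.2
    omega
  have hins : insert (y i) Y = Set.range y := by
    rw [← Set.image_insert_eq, ← Set.image_univ]
    congr 1
    ext j
    simp [em]
  obtain ⟨z, hz, hzU, hzY, hz'⟩ := exists_adj_linked hu h.finite hY (h.notMem i) (c := U.ncard + m)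
    (by have := Set.ncard_union_le U Y; omega)
    (fun A B h1 h2 h3 => h.le A B h1 h2 (hins ▸ h3))
  refine ⟨z, hz, h.finite.insert _, ?_, ?_, ?_⟩
  · intro a b hab
    by_cases ha : a = i <;> by_cases hb : b = i
    · rw [ha, hb]
    · subst ha
      rw [Function.update_self, Function.update_of_ne hb] at hab
      exact absurd ⟨b, hb, hab.symm⟩ hzY
    · subst hb
      rw [Function.update_self, Function.update_of_ne ha] at hab
      exact absurd ⟨a, ha, hab⟩ hzY
    · rw [Function.update_of_ne ha, Function.update_of_ne hb] at hab
      exact h.injective hab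
  · intro j
    by_cases hj : j = i
    · subst hj
      rwa [Function.update_self]
    · rw [Function.update_of_ne hj]
      rintro (h1 | h1)
      · exact hj (h.injective h1)
      · exact h.notMem j h1
  · intro A B h1 h2 h3
    have := hz' A B h1 h2 (Set.insert_subset (h3 ⟨i, by simp⟩) (by
      rintro _ ⟨j, hj, rfl⟩
      exact h3 ⟨j, by rw [Function.update_of_ne hj]⟩))
    rw [Set.ncard_insert_of_notMem (h.notMem i) h.finite]
    omega

/-- All members of a linked family are replaced by neighbours. -/
theorem LinkedOff.round (hu : ∀ v, ∃ A B, G.EndSep A B ∧ v ∈ A \ B) {U : Set V} {m : ℕ}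
    {y : Fin m → V} (h : G.LinkedOff U y) :
    ∃ U' y', G.LinkedOff U' y' ∧ U ⊆ U' ∧ ∀ i : Fin m, G.Adj (y i) (y' i) ∧ y i ∈ U' := by
  suffices ∀ s : Finset (Fin m), ∃ U' y', G.LinkedOff U' y' ∧ U ⊆ U' ∧
      (∀ i ∈ s, G.Adj (y i) (y' i) ∧ y i ∈ U') ∧ ∀ i ∉ s, y' i = y i by
    obtain ⟨U', y', h1, h2, h3, -⟩ := this Finset.univ
    exact ⟨U', y', h1, h2, fun i => h3 i (Finset.mem_univ i)⟩
  intro s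
  induction s using Finset.induction_on with
  | empty => exact ⟨U, y, h, subset_rfl, by simp, by simp⟩
  | insert i s hi ih =>
    obtain ⟨U', y', h1, h2, h3, h4⟩ := ih
    obtain ⟨z, hz, h5⟩ := h1.step hu i
    rw [h4 i hi] at hz h5
    refine ⟨_, _, h5, h2.trans (Set.subset_insert _ _), fun j hj => ?_, fun j hj => ?_⟩
    · by_cases hji : j = i
      · subst hji
        rw [Function.update_self]
        exact ⟨hz, Set.mem_insert _ _⟩
      · rw [Function.update_of_ne hji]
        have := h3 j (Finset.mem_of_mem_insert_of_ne hj hji)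
        exact ⟨this.1, Or.inr this.2⟩
    · rw [Finset.mem_insert, not_or] at hj
      rw [Function.update_of_ne hj.1, h4 j hj.2]

/-- Iterated replacement by neighbours turns a linked family into disjoint rays: the vertices
already used are deleted, so that they are never used again. -/
theorem LinkedOff.exists_rays (hu : ∀ v, ∃ A B, G.EndSep A B ∧ v ∈ A \ B) {m : ℕ}
    {y : Fin m → V} (h : G.LinkedOff ∅ y) :
    ∃ R : Fin m → G.Ray, Pairwise fun i j => Disjoint (R i).verts (R j).verts := by
  let T := {p : Set V × (Fin m → V) // G.LinkedOff p.1 p.2}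
  have hnext : ∀ p : T, ∃ q : T, p.1.1 ⊆ q.1.1 ∧ ∀ i, G.Adj (p.1.2 i) (q.1.2 i) ∧
      p.1.2 i ∈ q.1.1 := by
    rintro ⟨p, hp⟩
    obtain ⟨U', y', h1, h2⟩ := hp.round hu
    exact ⟨⟨(U', y'), h1⟩, h2⟩
  choose next hsub hadj using hnext
  let p : ℕ → T := fun n => next^[n] ⟨(∅, y), h⟩
  have hp : ∀ n, p (n + 1) = next (p n) := fun n => Function.iterate_succ_apply' _ _ _
  have hmono : Monotone fun n => (p n).1.1 := monotone_nat_of_le_succ fun n => by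
    rw [hp]
    exact hsub _
  have hne : ∀ a b i j, a < b → (p a).1.2 i ≠ (p b).1.2 j := by
    intro a b i j hab heq
    apply (p b).2.notMem j
    rw [← heq]
    apply hmono (Nat.succ_le_of_lt hab)
    change _ ∈ (p (a + 1)).1.1
    rw [hp]
    exact (hadj _ i).2
  refine ⟨fun i => ⟨fun n => (p n).1.2 i, fun a b hab => ?_, fun n => ?_⟩, fun i j hij => ?_⟩
  · rcases lt_trichotomy a b with hlt | heq | hlt
    · exact absurd hab (hne a b i i hlt)
    · exact heq
    · exact absurd hab.symm (hne b a i i hlt)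
  · rw [hp]
    exact (hadj _ i).1
  · refine Set.disjoint_left.2 ?_
    rintro _ ⟨a, rfl⟩ ⟨b, hab⟩
    change (p b).1.2 j = (p a).1.2 i at hab
    rcases lt_trichotomy a b with hlt | heq | hlt
    · exact hne a b i j hlt hab.symm
    · subst heq
      exact hij ((p a).2.injective hab).symm
    · exact hne b a j i hlt hab

/-! ### Graphs with a single thin end -/

/-- The properties of a connected one-ended graph with an undominated end of vertex degree `k` on
which the construction of the tree rests: outside each finite set there is a component that contains
a tail of every ray, each finite set lies strictly on the small side of a separation of finite order
and weakly on the small side of one of order at most `k`, and some finite set cannot be separated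
from the end by fewer than `k` vertices. -/
structure ThinEnd (G : SimpleGraph V) (k : ℕ) : Prop where
  connected : G.Connected
  exists_ray : Nonempty G.Ray
  exists_far : ∀ S : Set V, S.Finite →
    ∃ D, G.IsConn D ∧ D ∩ S = ∅ ∧ G.bdry D ⊆ S ∧ G.Carries D
  exists_endSep : ∀ X : Set V, X.Finite → ∃ A B, G.EndSep A B ∧ X ⊆ A \ B
  exists_linked : ∃ Y : Set V, Y.Finite ∧ G.Linked k Y
  exists_endSep_le : ∀ X : Set V, X.Finite → ∃ A B, G.EndSep A B ∧ X ⊆ A ∧ (A ∩ B).ncard ≤ k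

theorem RayEnd.liesIn_iff_carries {ω : G.RayEnd} (hone : ∀ η : G.RayEnd, η = ω) {B : Set V} :
    ω.LiesIn B ↔ G.Carries B :=
  ⟨fun h R => h R (hone _), fun h R _ => h R⟩

theorem IsSeparation.finSep {A B : Set V} (h : G.IsSeparation (A, B)) (hf : (A ∩ B).Finite) :
    G.FinSep A B :=
  ⟨fun v => (Set.eq_univ_iff_forall.1 h.1 v : v ∈ A ∪ B),
    fun a ha b hb h1 h2 => h.2 a ⟨ha, h1⟩ b ⟨hb, h2⟩, hf⟩

theorem FinSep.isSeparation {A B : Set V} (h : G.FinSep A B) : G.IsSeparation (A, B) :=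
  ⟨Set.eq_univ_iff_forall.2 h.cover, fun a ha b hb => h.no_adj a ha.1 b hb.1 ha.2 hb.2⟩

theorem RayEnd.exists_disjoint_rays {ω : G.RayEnd} {k : ℕ} (hk : ω.vertexDegree = k) :
    ∃ R : Fin k → G.Ray, Pairwise fun i j => Disjoint (R i).verts (R j).verts := by
  rcases Nat.eq_zero_or_pos k with rfl | hpos
  · exact ⟨fun i => i.elim0, fun i => i.elim0⟩
  have hlt : ((k - 1 : ℕ) : ℕ∞) < ω.vertexDegree := by
    rw [hk]
    exact_mod_cast Nat.sub_lt hpos one_pos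
  obtain ⟨d, ⟨m, R, rfl, -, hR⟩, hd⟩ := lt_sSup_iff.1 hlt
  have hm : k ≤ m := by
    have : k - 1 < m := by exact_mod_cast hd
    omega
  refine ⟨fun i => R (Fin.castLE hm i), fun i j hij => hR fun h => hij ?_⟩
  exact Fin.castLE_injective hm h

theorem RayEnd.le_of_disjoint_rays {ω : G.RayEnd} (hone : ∀ η : G.RayEnd, η = ω) {k : ℕ}
    (hk : ω.vertexDegree = k) {m : ℕ} (R : Fin m → G.Ray)
    (hR : Pairwise fun i j => Disjoint (R i).verts (R j).verts) : m ≤ k := by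
  have : (m : ℕ∞) ≤ ω.vertexDegree := le_sSup ⟨m, R, rfl, fun i => hone _, hR⟩
  rw [hk] at this
  exact_mod_cast this

/-- A ray that starts in `A` passes through the separator of an `EndSep A B`. -/
theorem EndSep.exists_vert_mem {A B : Set V} (h : G.EndSep A B) (R : G.Ray) (h0 : R.vert 0 ∈ A) :
    ∃ n, R.vert n ∈ A ∩ B := by
  classical
  obtain ⟨N, hN⟩ := (h.carries R).exists
  have hex : ∃ n, R.vert n ∈ B := ⟨N, hN⟩
  refine ⟨Nat.find hex, ?_, Nat.find_spec hex⟩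
  rcases hn : Nat.find hex with _ | n
  · exact h0
  · have h1 : R.vert n ∉ B := Nat.find_min hex (by omega)
    by_contra h2
    refine h.no_adj _ ((h.cover _).resolve_right h1) _ ?_ h1 h2 (R.adj n)
    rw [← hn]
    exact Nat.find_spec hex

/-- A maximal linked family has exactly `k` members: at most `k` because it spans disjoint rays, and
at least `k` because otherwise `k` disjoint rays would cross a separation of order below `k`. -/
theorem thinEnd_of_end (hconn : G.Connected) {ω : G.RayEnd} (hone : ∀ η : G.RayEnd, η = ω)
    (hundom : ∀ v : V, ¬ Dominates v ω) {k : ℕ} (hk : ω.vertexDegree = k) : G.ThinEnd k := by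
  have hu : ∀ v, ∃ A B, G.EndSep A B ∧ v ∈ A \ B := by
    intro v
    obtain ⟨⟨A, B⟩, h1, h2, h3, h4⟩ := not_not.1 (hundom v)
    exact ⟨A, B, ⟨h1.finSep h2, (RayEnd.liesIn_iff_carries hone).1 h4⟩, h3⟩
  obtain ⟨R0, hR0⟩ : ∃ R : G.Ray, R.toEnd = ω := Quotient.exists_rep ω
  have hm : ∃ m, (∃ y : Fin m → V, G.LinkedOff ∅ y) ∧ ¬ ∃ y : Fin (m + 1) → V, G.LinkedOff ∅ y := by
    by_contra hcon
    push Not at hcon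
    have : ∀ m, ∃ y : Fin m → V, G.LinkedOff ∅ y := by
      intro m
      induction m with
      | zero =>
        exact ⟨fun i => i.elim0, Set.finite_empty, fun i => i.elim0, fun i => i.elim0, by simp⟩
      | succ m ih => exact hcon m ih
    obtain ⟨y, hy⟩ := this (k + 1)
    obtain ⟨R, hR⟩ := hy.exists_rays hu
    have := RayEnd.le_of_disjoint_rays hone hk R hR
    omega
  -- The family `y` of `m` linked vertices cannot be extended by a further vertex.
  obtain ⟨m, ⟨y, hy⟩, hmax⟩ := hm
  have hmk : m ≤ k := by
    obtain ⟨R, hR⟩ := hy.exists_rays hu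
    exact RayEnd.le_of_disjoint_rays hone hk R hR
  have hyL : G.Linked m (Set.range y) := fun A B h1 h2 => by
    simpa using hy.le A B h1 (by simp) h2
  have hyc : (Set.range y).ncard = m := by
    rw [← Set.image_univ, Set.ncard_image_of_injective _ hy.injective]
    simp
  have hbase : G.EndSep (Set.range y) Set.univ :=
    ⟨⟨by simp, by simp, by simpa using Set.finite_range y⟩, fun R => by simp [Ray.LiesIn]⟩
  have hsep1 : ∀ x, ∃ A B, G.EndSep A B ∧ x ∈ A ∧ Set.range y ⊆ A ∧ (A ∩ B).ncard ≤ m := by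
    intro x
    by_cases hx : x ∈ Set.range y
    · exact ⟨_, _, hbase, hx, subset_rfl, by rw [Set.inter_univ, hyc]⟩
    by_contra hcon
    push Not at hcon
    refine hmax ⟨Fin.cons x y, Set.finite_empty, ?_, by simp, fun A B h1 _ h3 => ?_⟩
    · exact Fin.cons_injective_iff.2 ⟨hx, hy.injective⟩
    · rw [Fin.range_cons] at h3
      have := hcon A B h1 (h3 (Set.mem_insert _ _)) ((Set.subset_insert _ _).trans h3)
      simp only [Set.ncard_empty]
      omega
  have hsep : ∀ X : Set V, X.Finite →
      ∃ A B, G.EndSep A B ∧ X ⊆ A ∧ Set.range y ⊆ A ∧ (A ∩ B).ncard ≤ m := by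
    intro X hX
    induction X, hX using Set.Finite.induction_on with
    | empty => exact ⟨_, _, hbase, by simp, subset_rfl, by rw [Set.inter_univ, hyc]⟩
    | @insert a X _ _ ih =>
      obtain ⟨A, B, h1, h2, h3, h4⟩ := ih
      obtain ⟨C, D, k1, k2, k3, k4⟩ := hsep1 a
      refine ⟨A ∪ C, B ∩ D, h1.union k1, Set.insert_subset (Or.inr k2)
        (h2.trans Set.subset_union_left), h3.trans Set.subset_union_left, ?_⟩
      have h5 := h1.toFinSep.ncard_add_ncard k1.toFinSep
      have h6 := hyL _ _ (h1.inter k1.toFinSep) (Set.subset_inter h3 k3)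
      omega
  have hkm : m = k := by
    apply le_antisymm hmk
    obtain ⟨R, hR⟩ := RayEnd.exists_disjoint_rays hk
    obtain ⟨A, B, h1, h2, -, h4⟩ := hsep (Set.range fun i => (R i).vert 0) (Set.finite_range _)
    choose n hn using fun i => h1.exists_vert_mem (R i) (h2 ⟨i, rfl⟩)
    have hinj : Function.Injective fun i => (R i).vert (n i) := by
      intro i j hij
      by_contra hne
      refine Set.disjoint_left.1 (hR hne) ⟨n i, rfl⟩ ⟨n j, ?_⟩
      exact hij.symm
    have h5 : Set.range (fun i => (R i).vert (n i)) ⊆ A ∩ B := by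
      rintro _ ⟨i, rfl⟩
      exact hn i
    have h6 := Set.ncard_le_ncard h5 h1.finite
    rw [← Set.image_univ, Set.ncard_image_of_injective _ hinj] at h6
    simp only [Set.ncard_univ, Nat.card_eq_fintype_card, Fintype.card_fin] at h6
    omega
  subst hkm
  refine ⟨hconn, ⟨R0⟩, fun S hS => ?_, fun X hX => exists_endSep_of_finite hu hX,
    ⟨_, Set.finite_range y, hyL⟩, fun X hX => ?_⟩
  · obtain ⟨C, hC⟩ := R0.exists_liesIn hS
    obtain ⟨v, hv⟩ := C.nonempty
    have hclosed : ∀ a ∈ (C : Set V), ∀ b ∉ S, G.Adj a b → b ∈ (C : Set V) :=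
      fun a ha b hb hab => ComponentCompl.mem_of_adj a b ha hb hab
    have hdis : ∀ a ∈ (C : Set V), a ∉ S := fun a ha => ComponentCompl.notMem_of_mem ha
    refine ⟨C, ⟨⟨v, hv⟩, fun P hP hne hcl => ?_⟩, ?_, ?_, fun R => ?_⟩
    · apply hP.antisymm
      obtain ⟨p, hp⟩ := hne
      have key : ∀ (x y : V) (hx : x ∉ S) (hy : y ∉ S), x ∈ P →
          G.componentComplMk hx = G.componentComplMk hy → y ∈ P := by
        intro x y hx hy hxP hxy
        obtain ⟨w⟩ := ConnectedComponent.eq.1 hxy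
        suffices ∀ (a b : (Sᶜ : Set V)), (G.induce Sᶜ).Walk a b → a.1 ∈ P → b.1 ∈ P from
          this _ _ w hxP
        intro a b w
        induction w with
        | nil => exact id
        | @cons a b c hab _ ih =>
          intro ha
          have hab' : G.Adj a.1 b.1 := hab
          exact ih (hcl _ ha _ (hclosed _ (hP ha) _ b.2 hab') hab')
      intro q hq
      obtain ⟨hpS, hp'⟩ := ComponentCompl.mem_supp_iff.1 (hP hp)
      obtain ⟨hqS, hq'⟩ := ComponentCompl.mem_supp_iff.1 hq
      exact key p q hpS hqS hp (hp'.trans hq'.symm)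
    · exact Set.eq_empty_iff_forall_notMem.2 fun a ha => hdis a ha.1 ha.2
    · rintro b ⟨hb, a, ha, hab⟩
      by_contra hbS
      exact hb (hclosed a ha b hbS hab)
    · have hsame : R.SameEnd R0 := Quotient.exact ((hone R.toEnd).trans hR0.symm)
      obtain ⟨C', h1, h2⟩ := hsame S hS
      obtain ⟨n, hn, hn'⟩ := (hC.and h2).exists
      have : C = C' := by
        by_contra hne
        exact Set.disjoint_left.1 (ComponentCompl.pairwise_disjoint hne) hn hn'
      rw [this]
      exact h1
  · obtain ⟨A, B, h1, h2, -, h4⟩ := hsep X hX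
    exact ⟨A, B, h1, h2, h4⟩

variable {k : ℕ}

/-! ### Regions -/

/-- A region is a connected vertex set `K` with exactly `k` boundary vertices that avoids a tail of
every ray and whose closure is linked to the end. The relevant separations are the pairs
`(clos K, Kᶜ)` for regions `K`. -/
structure Region (G : SimpleGraph V) (k : ℕ) (K : Set V) : Prop where
  isConn : G.IsConn K
  finite_bdry : (G.bdry K).Finite
  ncard_bdry : (G.bdry K).ncard = k
  carries : G.Carries Kᶜ
  linked : G.Linked k (G.clos K)

theorem Region.endSep {K : Set V} (h : G.Region k K) : G.EndSep (G.clos K) Kᶜ :=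
  ⟨finSep_clos h.finite_bdry, h.carries⟩

theorem Region.linked_bdry {K : Set V} (h : G.Region k K) : G.Linked k (G.bdry K) :=
  h.linked.bdry h.carries

theorem ThinEnd.not_carries_compl (hG : G.ThinEnd k) {B : Set V} (h : G.Carries B)
    (h' : G.Carries Bᶜ) : False := by
  obtain ⟨R⟩ := hG.exists_ray
  obtain ⟨n, h1, h2⟩ := ((h R).and (h' R)).exists
  exact h2 h1

/-- If `A ∩ B` has at most `k` vertices and `Z ⊆ A \ B` is connected with linked closure, then the
component of `A \ B` that contains `Z` is a region with boundary `A ∩ B`: its boundary lies in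
`A ∩ B` and has at least `k` vertices. -/
theorem region_compIn {A B : Set V} (h : G.EndSep A B) (hc : (A ∩ B).ncard ≤ k) {Z : Set V}
    (hZ : G.IsConn Z) (hZA : Z ⊆ A \ B) (hl : G.Linked k (G.clos Z)) {x : V} (hx : x ∈ Z) :
    G.Region k (G.compIn (A \ B) x) ∧ G.bdry (G.compIn (A \ B) x) = A ∩ B := by
  have hR : G.compIn (A \ B) x ⊆ A \ B := compIn_subset (hZA hx)
  have hb : G.bdry (G.compIn (A \ B) x) ⊆ A ∩ B := by
    rintro v ⟨hv, w, hw, hwv⟩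
    have hvAB : v ∉ A \ B := fun h' =>
      hv (Relation.ReflTransGen.tail hw ⟨hwv, h'⟩)
    have hvA : v ∈ A := by
      by_contra hvA
      exact h.no_adj w (hR hw).1 v ((h.cover v).resolve_left hvA) (hR hw).2 hvA hwv
    exact ⟨hvA, by_contra fun hvB => hvAB ⟨hvA, hvB⟩⟩
  have hfin : (G.bdry (G.compIn (A \ B) x)).Finite := h.finite.subset hb
  have hcar : G.Carries (G.compIn (A \ B) x)ᶜ := h.carries.mono fun v hv hv' => (hR hv').2 hv
  have hlin : G.Linked k (G.clos (G.compIn (A \ B) x)) :=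
    hl.mono (clos_mono (hZ.subset_compIn hZA hx))
  have hk : k ≤ (G.bdry (G.compIn (A \ B) x)).ncard := by
    have := hlin _ _ ⟨finSep_clos hfin, hcar⟩ subset_rfl
    rwa [clos_inter_compl] at this
  have heq := Set.eq_of_subset_of_ncard_le hb (hc.trans hk) h.finite
  exact ⟨⟨isConn_compIn _ _, hfin, le_antisymm (heq ▸ hc) hk, hcar, hlin⟩, heq⟩

/-- If the closures of two touching regions have a linked intersection, then the union is a
region, by modularity. -/
theorem Region.union {M N : Set V} (hM : G.Region k M) (hN : G.Region k N)
    (ht : (M ∩ G.clos N).Nonempty) (hl : G.Linked k (G.clos M ∩ G.clos N)) :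
    G.Region k (M ∪ N) := by
  have h1 := hM.endSep.toFinSep.ncard_add_ncard hN.endSep.toFinSep
  have h2 := hl _ _ (hM.endSep.inter hN.endSep.toFinSep) subset_rfl
  have h3 := hM.endSep.union hN.endSep
  rw [clos_inter_compl, clos_inter_compl, hM.ncard_bdry, hN.ncard_bdry] at h1
  rw [← clos_union, ← Set.compl_union] at h1 h3
  rw [clos_inter_compl] at h1
  have hfin : (G.bdry (M ∪ N)).Finite := by
    have := h3.finite
    rwa [clos_inter_compl] at this
  have hlin : G.Linked k (G.clos (M ∪ N)) := hM.linked.mono (clos_mono Set.subset_union_left)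
  have h4 := hlin _ _ h3 subset_rfl
  rw [clos_inter_compl] at h4
  exact ⟨hM.isConn.union hN.isConn ht, hfin, by omega, h3.carries, hlin⟩

theorem Region.union_of_subset {M N K : Set V} (hM : G.Region k M) (hN : G.Region k N)
    (hK : G.Region k K) (hKM : K ⊆ M) (hKN : K ⊆ N) : G.Region k (M ∪ N) := by
  obtain ⟨x, hx⟩ := hK.isConn.1
  exact hM.union hN ⟨x, hKM hx, Or.inl (hKN hx)⟩
    (hK.linked.mono (Set.subset_inter (clos_mono hKM) (clos_mono hKN)))

/-- Every finite set lies in a region. The separation that cuts the region out is the union of one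
that has a connected linked set `Z` strictly on its small side and one of order at most `k` that
contains the separator of the former. -/
theorem ThinEnd.exists_region (hG : G.ThinEnd k) {X : Set V} (hX : X.Finite) :
    ∃ K, G.Region k K ∧ X ⊆ K := by
  obtain ⟨Y, hYf, hY⟩ := hG.exists_linked
  obtain ⟨R⟩ := hG.exists_ray
  obtain ⟨Z, hXZ, hZf, hZ⟩ := exists_finite_isConn hG.connected
    ((hX.union hYf).insert (R.vert 0)) ⟨_, Set.mem_insert _ _⟩
  obtain ⟨C, D, hCD, hZC⟩ := hG.exists_endSep Z hZf
  obtain ⟨A, B, hAB, hA, hc⟩ := hG.exists_endSep_le (C ∩ D) hCD.finite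
  have hZA : Z ⊆ (A ∪ C) \ (B ∩ D) := fun v hv => ⟨Or.inr (hZC hv).1, fun h => (hZC hv).2 h.2⟩
  have hle : ((A ∪ C) ∩ (B ∩ D)).ncard ≤ k := by
    refine (Set.ncard_le_ncard ?_ hAB.finite).trans hc
    rintro v ⟨hv | hv, hB, hD⟩
    · exact ⟨hv, hB⟩
    · exact ⟨hA ⟨hv, hD⟩, hB⟩
  have hsub : X ∪ Y ⊆ Z := (Set.subset_insert _ _).trans hXZ
  obtain ⟨x, hx⟩ := hZ.1
  have hl : G.Linked k (G.clos Z) :=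
    hY.mono ((Set.subset_union_right.trans hsub).trans (subset_clos Z))
  exact ⟨_, (region_compIn (hAB.union hCD) hle hZ hZA hl hx).1,
    (Set.subset_union_left.trans hsub).trans (hZ.subset_compIn hZA hx)⟩

/-- The regions are directed: a region that contains the boundary of `M` can be merged with `M`. -/
theorem ThinEnd.exists_region_of_finite (hG : G.ThinEnd k) {F : Set (Set V)} (hF : F.Finite)
    (hFr : ∀ K ∈ F, G.Region k K) {X : Set V} (hX : X.Finite) :
    ∃ J, G.Region k J ∧ X ⊆ J ∧ ∀ K ∈ F, K ⊆ J := by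
  induction F, hF using Set.Finite.induction_on generalizing X with
  | empty =>
    obtain ⟨K, h1, h2⟩ := hG.exists_region hX
    exact ⟨K, h1, h2, by simp⟩
  | @insert M F _ _ ih =>
    have hM := hFr M (Set.mem_insert _ _)
    obtain ⟨x, hx⟩ := hM.isConn.1
    obtain ⟨J, h1, h2, h3⟩ := ih (fun K hK => hFr K (Or.inr hK))
      ((hX.union hM.finite_bdry).insert x)
    refine ⟨J ∪ M, h1.union hM ⟨x, h2 (Set.mem_insert _ _), Or.inl hx⟩ ?_, ?_, ?_⟩
    · refine hM.linked_bdry.mono (Set.subset_inter (fun v hv => ?_) (bdry_subset_clos M))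
      exact subset_clos J (h2 (Or.inr (Or.inr hv)))
    · exact fun v hv => Or.inl (h2 (Or.inr (Or.inl hv)))
    · rintro K (rfl | hK)
      · exact Set.subset_union_right
      · exact (h3 K hK).trans Set.subset_union_left

/-- The side of the end: a connected set beyond a region, with the same boundary. -/
theorem Region.exists_far (hG : G.ThinEnd k) {N : Set V} (hN : G.Region k N) :
    ∃ D, G.IsConn D ∧ D ∩ G.clos N = ∅ ∧ G.bdry D = G.bdry N ∧ G.Carries D := by
  obtain ⟨D, h1, h2, h3, h4⟩ := hG.exists_far _ hN.finite_bdry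
  have hDN : D ∩ N = ∅ := by
    by_contra hne
    have := h1.subset_of_disjoint_bdry (Set.nonempty_iff_ne_empty.2 hne) h2
    exact hG.not_carries_compl (h4.mono this) hN.carries
  have hD : D ∩ G.clos N = ∅ := by
    rw [clos, Set.inter_union_distrib_left, hDN, h2, Set.union_empty]
  refine ⟨D, h1, hD, ?_, h4⟩
  have hf := hN.finite_bdry.subset h3
  have := hN.linked Dᶜ (G.clos D) ⟨(finSep_clos hf).symm, h4.mono (subset_clos D)⟩
    (fun v hv hvD => Set.eq_empty_iff_forall_notMem.1 hD v ⟨hvD, hv⟩)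
  rw [Set.inter_comm, clos_inter_compl, ← hN.ncard_bdry] at this
  exact Set.eq_of_subset_of_ncard_le h3 this hN.finite_bdry

/-! ### Finiteness -/

/-- There are only finitely many minimal separators of a given finite size between two vertices. -/
theorem finite_minimal_separators (x y : V) (n : ℕ) (F : Set V) :
    {S : Set V | F ⊆ S ∧ S.Finite ∧ (S \ F).ncard = n ∧ ¬ G.ReachIn Sᶜ x y ∧
      ∀ s ∈ S, G.ReachIn (S \ {s})ᶜ x y}.Finite := by
  induction n generalizing F with
  | zero =>
    refine (Set.finite_singleton F).subset ?_
    rintro S ⟨h1, h2, h3, -⟩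
    rw [Set.ncard_eq_zero (h2.subset Set.sdiff_subset), Set.sdiff_eq_empty] at h3
    exact h3.antisymm h1
  | succ n ih =>
    by_cases hr : G.ReachIn Fᶜ x y
    · -- Every separator containing `F` meets the given walk outside `F`.
      obtain ⟨P, hPF, hPf, hP, -⟩ := hr.exists_finite
      refine (hPf.biUnion fun v _ => ih (insert v F)).subset ?_
      rintro S ⟨h1, h2, h3, h4, h5⟩
      obtain ⟨v, hvP, hvS⟩ : ∃ v ∈ P, v ∈ S := by
        by_contra hcon
        push Not at hcon
        exact h4 (hP.mono hcon)
      refine Set.mem_biUnion hvP ⟨Set.insert_subset hvS h1, h2, ?_, h4, h5⟩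
      have h6 : S \ insert v F = (S \ F) \ {v} := by
        ext w
        simp only [Set.mem_sdiff, Set.mem_insert_iff, Set.mem_singleton_iff]
        tauto
      have h7 : v ∈ S \ F := ⟨hvS, hPF hvP⟩
      rw [h6, Set.ncard_sdiff_singleton_of_mem h7, h3]
      rfl
    · convert Set.finite_empty
      rw [Set.eq_empty_iff_forall_notMem]
      rintro S ⟨h1, h2, h3, h4, h5⟩
      obtain ⟨s, hs⟩ : (S \ F).Nonempty := by
        rw [← Set.ncard_pos (h2.subset Set.sdiff_subset)]
        omega
      have hsub : (S \ {s})ᶜ ⊆ Fᶜ := fun v hv hvF => hv ⟨h1 hvF, fun h => hs.2 (h ▸ hvF)⟩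
      exact hr ((h5 s hs.1).mono hsub)

theorem ReachIn.mem_of_disjoint_bdry {Z N : Set V} (hZ : Z ∩ G.bdry N = ∅) {x y : V} (hx : x ∈ N)
    (h : G.ReachIn Z x y) : y ∈ N := by
  induction h with
  | refl => exact hx
  | tail _ h ih =>
    exact (mem_clos_of_adj ih h.1).resolve_right
      fun h' => Set.eq_empty_iff_forall_notMem.1 hZ _ ⟨h.2, h'⟩

/-- Regions containing a given vertex are determined by their boundaries. If the boundary of `N`
meets `J`, then some boundary vertex of `J` lies beyond `N`, so that the boundary of `N` is a
minimal separator between two vertices for which there are finitely many choices. -/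
theorem Region.finite_bdry_meets (hG : G.ThinEnd k) {J : Set V} (hJ : G.Region k J) (u : V) :
    {N | G.Region k N ∧ u ∈ N ∧ (J ∩ G.bdry N).Nonempty}.Finite := by
  refine Set.Finite.of_finite_image (f := G.bdry) ?_ ?_
  · refine (hJ.finite_bdry.biUnion fun w _ => finite_minimal_separators (G := G) u w k ∅).subset ?_
    rintro _ ⟨N, ⟨hN, hu, v, hvJ, hv⟩, rfl⟩
    obtain ⟨D, h1, h2, h3, h4⟩ := hN.exists_far hG
    have hDb : D ∩ G.bdry N = ∅ := by
      rw [Set.eq_empty_iff_forall_notMem]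
      exact fun w hw => Set.eq_empty_iff_forall_notMem.1 h2 w ⟨hw.1, Or.inr hw.2⟩
    obtain ⟨w, hwD, hwJ⟩ : (D ∩ G.bdry J).Nonempty := by
      by_contra hne
      obtain ⟨-, d, hd, hdv⟩ := h3.symm.subset hv
      have hdJ : d ∈ J := (mem_clos_of_adj hvJ hdv.symm).resolve_right fun h => hne ⟨d, hd, h⟩
      have := h1.subset_of_disjoint_bdry ⟨d, hd, hdJ⟩ (Set.not_nonempty_iff_eq_empty.1 hne)
      exact hG.not_carries_compl (h4.mono this) hJ.carries
    refine Set.mem_biUnion hwJ ⟨Set.empty_subset _, hN.finite_bdry, ?_, fun h => ?_, fun s hs => ?_⟩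
    · rw [Set.sdiff_empty, hN.ncard_bdry]
    · have := h.mem_of_disjoint_bdry (Set.compl_inter_self _) hu
      exact Set.eq_empty_iff_forall_notMem.1 h2 w ⟨hwD, Or.inl this⟩
    · have hsN := hs
      obtain ⟨-, a, ha, has⟩ := hsN
      obtain ⟨hsD, d, hd, hds⟩ := h3.symm.subset hs
      have hN' : N ⊆ (G.bdry N \ {s})ᶜ := fun z hz hz' => hz'.1.1 hz
      have hD' : D ⊆ (G.bdry N \ {s})ᶜ := fun z hz hz' =>
        Set.eq_empty_iff_forall_notMem.1 hDb z ⟨hz, hz'.1⟩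
      have r1 := (hN.isConn.reachIn hu ha).mono hN'
      have r2 := (h1.reachIn hd hwD).mono hD'
      exact (r1.tail ⟨has, fun h => h.2 rfl⟩).trans
        (Relation.ReflTransGen.head ⟨hds.symm, hD' hd⟩ r2)
  · rintro N ⟨hN, hu, -⟩ N' ⟨hN', hu', -⟩ heq
    apply Set.Subset.antisymm
    · exact hN.isConn.subset_of_disjoint_bdry ⟨u, hu, hu'⟩ (by
        rw [← heq]
        exact Set.eq_empty_iff_forall_notMem.2 fun v hv => hv.2.1 hv.1)
    · exact hN'.isConn.subset_of_disjoint_bdry ⟨u, hu', hu⟩ (by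
        rw [heq]
        exact Set.eq_empty_iff_forall_notMem.2 fun v hv => hv.2.1 hv.1)

/-- All but finitely many of the regions above `K` contain a given region `J`. -/
theorem Region.finite_not_superset (hG : G.ThinEnd k) {J K : Set V} (hJ : G.Region k J)
    (hK : K.Nonempty) (hKJ : K ⊆ J) : {N | G.Region k N ∧ K ⊆ N ∧ ¬ J ⊆ N}.Finite := by
  obtain ⟨x, hx⟩ := hK
  refine (hJ.finite_bdry_meets hG x).subset ?_
  rintro N ⟨h1, h2, h3⟩
  refine ⟨h1, h2 hx, ?_⟩
  by_contra hne
  exact h3 (hJ.isConn.subset_of_disjoint_bdry ⟨x, hKJ hx, h2 hx⟩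
    (Set.not_nonempty_iff_eq_empty.1 hne))

/-- There are only finitely many regions between two given ones. -/
theorem Region.finite_between (hG : G.ThinEnd k) {J K : Set V} (hJ : G.Region k J)
    (hK : K.Nonempty) (hKJ : K ⊆ J) : {N | G.Region k N ∧ K ⊆ N ∧ N ⊆ J}.Finite := by
  refine ((hJ.finite_not_superset hG hK hKJ).union (Set.finite_singleton J)).subset ?_
  rintro N ⟨h1, h2, h3⟩
  by_cases h : J ⊆ N
  · exact Or.inr (h3.antisymm h)
  · exact Or.inl ⟨h1, h2, h⟩

/-! ### Crossing regions -/

/-- Two sets cross if each contains a boundary vertex of the other. -/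
def Cross (G : SimpleGraph V) (M N : Set V) : Prop :=
  (M ∩ G.bdry N).Nonempty ∧ (N ∩ G.bdry M).Nonempty

theorem Cross.symm {M N : Set V} (h : G.Cross M N) : G.Cross N M := ⟨h.2, h.1⟩

theorem Cross.touch {M N : Set V} (h : G.Cross M N) : (M ∩ G.clos N).Nonempty :=
  h.1.mono (Set.inter_subset_inter_right _ (bdry_subset_clos N))

theorem inter_clos_eq_empty_symm {M N : Set V} (h : M ∩ G.clos N = ∅) : N ∩ G.clos M = ∅ := by
  rw [Set.eq_empty_iff_forall_notMem] at h ⊢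
  rintro v ⟨hvN, hv | ⟨-, w, hw, hwv⟩⟩
  · exact h v ⟨hv, Or.inl hvN⟩
  · exact h w ⟨hw, mem_clos_of_adj hvN hwv.symm⟩

theorem clos_inter_eq_empty {M N : Set V} (h : M ∩ G.clos N = ∅) : G.clos M ∩ N = ∅ := by
  rw [Set.inter_comm]
  exact inter_clos_eq_empty_symm h

theorem inter_bdry_eq_empty_of_subset {M N : Set V} (h : M ⊆ N) : M ∩ G.bdry N = ∅ :=
  Set.eq_empty_iff_forall_notMem.2 fun _ hv => hv.2.1 (h hv.1)

theorem not_cross_of_subset {M N : Set V} (h : M ⊆ N) : ¬ G.Cross M N := fun hc => by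
  have := hc.1
  rw [inter_bdry_eq_empty_of_subset h] at this
  exact this.ne_empty rfl

theorem not_cross_of_superset {M N : Set V} (h : N ⊆ M) : ¬ G.Cross M N := fun hc =>
  not_cross_of_subset h hc.symm

theorem not_cross_of_inter_clos {M N : Set V} (h : M ∩ G.clos N = ∅) :
    ¬ G.Cross M N := fun hc => by
  have := hc.touch
  rw [h] at this
  exact this.ne_empty rfl

/-- Connected sets that do not cross are nested. -/
theorem IsConn.nested_of_not_cross {M N : Set V} (hM : G.IsConn M) (hN : G.IsConn N)
    (h : ¬ G.Cross M N) : M ⊆ N ∨ N ⊆ M ∨ M ∩ G.clos N = ∅ := by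
  have key : ∀ {M N : Set V}, G.IsConn M → M ∩ G.bdry N = ∅ → M ⊆ N ∨ M ∩ G.clos N = ∅ := by
    intro M N hM h1
    by_cases h2 : (M ∩ N).Nonempty
    · exact Or.inl (hM.subset_of_disjoint_bdry h2 h1)
    · right
      rw [clos, Set.inter_union_distrib_left, h1, Set.not_nonempty_iff_eq_empty.1 h2,
        Set.union_empty]
  by_cases h1 : (M ∩ G.bdry N).Nonempty
  · have h2 : N ∩ G.bdry M = ∅ := Set.not_nonempty_iff_eq_empty.1 fun h2 => h ⟨h1, h2⟩
    rcases key hN h2 with h3 | h3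
    · exact Or.inr (Or.inl h3)
    · exact Or.inr (Or.inr (inter_clos_eq_empty_symm h3))
  · rcases key hM (Set.not_nonempty_iff_eq_empty.1 h1) with h3 | h3
    · exact Or.inl h3
    · exact Or.inr (Or.inr h3)

theorem Region.finite_cross (hG : G.ThinEnd k) {M : Set V} (hM : G.Region k M) :
    {N | G.Region k N ∧ G.Cross M N}.Finite := by
  refine (hM.finite_bdry.biUnion fun w _ => hM.finite_bdry_meets hG w).subset ?_
  rintro N ⟨h1, h2, v, hvN, hv⟩
  exact Set.mem_biUnion hv ⟨h1, hvN, h2⟩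

/-! ### Descending chains of regions -/

/-- One step in the construction of a ray inside a descending sequence of regions: the current
vertex `y` reaches all members of the sequence, and one of its neighbours does so without using `y`
again, because some member is separated from `y` by a finite set. -/
theorem exists_adj_reachIn {K : ℕ → Set V} (hanti : Antitone K) {U : Set V} {y : V} {m : ℕ}
    (hfin : (G.bdry (K m)).Finite) (hy : y ∉ G.clos (K m))
    (h : ∀ n, ∃ z ∈ K n, G.ReachIn Uᶜ y z) :
    ∃ y', G.Adj y y' ∧ y' ∉ insert y U ∧ ∀ n, ∃ z ∈ K n, G.ReachIn (insert y U)ᶜ y' z := by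
  have hstep : ∀ n, ∃ s ∈ G.bdry (K m), ∃ y', G.Adj y y' ∧ y' ∉ insert y U ∧
      G.ReachIn (insert y U)ᶜ y' s ∧ ∃ z ∈ K n, G.ReachIn (insert y U)ᶜ s z := by
    intro n
    obtain ⟨z, hz, hyz⟩ := h (max n m)
    have hzm := hanti (le_max_right n m) hz
    have hne : y ≠ z := fun h => hy (Or.inl (h ▸ hzm))
    obtain ⟨y', h1, h2, h3⟩ := hyz.exists_first_step hne
    have hy' : y' ∉ K m := fun h' => hy (mem_clos_of_adj h' h1.symm)
    obtain ⟨s, hs, h4, h5⟩ := h3.exists_mem_bdry hy' hzm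
    exact ⟨s, hs, y', h1, h2, h4, z, hanti (le_max_left n m) hz, h5⟩
  choose s hs hs' using hstep
  have : Finite (G.bdry (K m)) := hfin
  obtain ⟨t, ht⟩ := Finite.exists_infinite_fiber fun n => (⟨s n, hs n⟩ : G.bdry (K m))
  have ht' := Set.infinite_coe_iff.1 ht
  obtain ⟨n1, hn1⟩ := ht'.nonempty
  have e1 : s n1 = t := congrArg Subtype.val hn1
  obtain ⟨y', h1, h2, h3, -⟩ := hs' n1
  refine ⟨y', h1, h2, fun n => ?_⟩
  obtain ⟨n', hn', hlt⟩ := ht'.exists_gt n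
  have e2 : s n' = t := congrArg Subtype.val hn'
  obtain ⟨-, -, -, -, z, hz, h4⟩ := hs' n'
  rw [e1] at h3
  rw [e2] at h4
  exact ⟨z, hanti hlt.le hz, h3.trans h4⟩

/-- Regions satisfy the descending chain condition: an infinite descending sequence would give a
ray inside a region. -/
theorem ThinEnd.not_descending (hG : G.ThinEnd k) (K : ℕ → Set V) (hK : ∀ n, G.Region k (K n))
    (hlt : ∀ n, K (n + 1) ⊂ K n) : False := by
  have hanti : StrictAnti K := strictAnti_nat_of_succ_lt hlt
  have hmem : ∀ v, ∃ n, v ∉ K n := by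
    by_contra hcon
    push Not at hcon
    obtain ⟨v, hv⟩ := hcon
    refine Set.infinite_of_injective_forall_mem (f := fun n => K (n + 1))
      (fun a b hab => by simpa using hanti.injective hab) (fun n => ?_)
      ((hK 0).finite_bdry_meets hG v)
    refine ⟨hK _, hv _, ?_⟩
    by_contra hne
    exact (hanti (Nat.succ_pos n)).2 ((hK 0).isConn.subset_of_disjoint_bdry ⟨v, hv 0, hv _⟩
      (Set.not_nonempty_iff_eq_empty.1 hne))
  -- Discard an initial part such that the vertices that are eventually boundary vertices are
  -- boundary vertices from the start.
  let E : ℕ → Set V := fun n => {v | ∀ i ≥ n, v ∈ G.bdry (K i)}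
  have hEsub : ∀ n, E n ⊆ G.bdry (K n) := fun n v hv => hv n le_rfl
  have hEmono : Monotone E := fun a b hab v hv i hi => hv i (hab.trans hi)
  have hEfin : ∀ n, (E n).Finite := fun n => (hK n).finite_bdry.subset (hEsub n)
  have hEk : ∀ n, (E n).ncard ≤ k := fun n =>
    (Set.ncard_le_ncard (hEsub n) (hK n).finite_bdry).trans (hK n).ncard_bdry.le
  obtain ⟨n0, hn0⟩ : ∃ n0, ∀ n, k - (E n0).ncard ≤ k - (E n).ncard :=
    ⟨Function.argmin fun n => k - (E n).ncard,
      fun n => Function.argmin_le (fun n => k - (E n).ncard) n⟩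
  have hE : ∀ n, n0 ≤ n → E n = E n0 := fun n hn => by
    refine (Set.eq_of_subset_of_ncard_le (hEmono hn) ?_ (hEfin n)).symm
    have := hn0 n
    have := hEk n
    have := hEk n0
    omega
  have hsep : ∀ v ∈ K n0, ∃ m, v ∉ G.clos (K m) := by
    intro v hv
    by_contra hcon
    push Not at hcon
    obtain ⟨a, ha⟩ := hmem v
    have : v ∈ E (max a n0) := fun i hi => (hcon i).resolve_left fun h =>
      ha (hanti.antitone ((le_max_left _ _).trans hi) h)
    rw [hE _ (le_max_right _ _)] at this
    exact (hEsub _ this).1 hv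
  -- A state consists of the set of deleted vertices and the current end vertex of the path.
  let T := {p : Set V × V // G.bdry (K n0) ⊆ p.1 ∧ p.2 ∈ K n0 ∧ p.2 ∉ p.1 ∧
    ∀ n, ∃ z ∈ K n, G.ReachIn p.1ᶜ p.2 z}
  have hnext : ∀ p : T, ∃ q : T, q.1.1 = insert p.1.2 p.1.1 ∧ G.Adj p.1.2 q.1.2 := by
    rintro ⟨⟨U, y⟩, h1, h2, h3, h4⟩
    obtain ⟨m, hm⟩ := hsep y h2
    obtain ⟨y', h5, h6, h7⟩ := exists_adj_reachIn hanti.antitone (hK m).finite_bdry hm h4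
    have hy' : y' ∈ K n0 := (mem_clos_of_adj h2 h5).resolve_right fun h => h6 (Or.inr (h1 h))
    exact ⟨⟨(insert y U, y'), h1.trans (Set.subset_insert _ _), hy', h6, h7⟩, rfl, h5⟩
  choose next hU hadj using hnext
  obtain ⟨y0, hy0⟩ := (hK n0).isConn.1
  have hstart : ∀ n, ∃ z ∈ K n, G.ReachIn (G.bdry (K n0))ᶜ y0 z := by
    intro n
    obtain ⟨z, hz⟩ := (hK (max n n0)).isConn.1
    have hsub : K n0 ⊆ (G.bdry (K n0))ᶜ := fun v hv hv' => hv'.1 hv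
    exact ⟨z, hanti.antitone (le_max_left _ _) hz,
      ((hK n0).isConn.reachIn hy0 (hanti.antitone (le_max_right n n0) hz)).mono hsub⟩
  let p : ℕ → T := fun n =>
    next^[n] ⟨(G.bdry (K n0), y0), subset_rfl, hy0, fun h => h.1 hy0, hstart⟩
  have hp : ∀ n, p (n + 1) = next (p n) := fun n => Function.iterate_succ_apply' _ _ _
  have hmono : Monotone fun n => (p n).1.1 := monotone_nat_of_le_succ fun n => by
    rw [hp, hU]
    exact Set.subset_insert _ _
  have hne : ∀ a b, a < b → (p a).1.2 ≠ (p b).1.2 := by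
    intro a b hab heq
    apply (p b).2.2.2.1
    rw [← heq]
    apply hmono (Nat.succ_le_of_lt hab)
    change _ ∈ (p (a + 1)).1.1
    rw [hp, hU]
    exact Set.mem_insert _ _
  let R : G.Ray := ⟨fun n => (p n).1.2, fun a b hab => by
    rcases lt_trichotomy a b with h | h | h
    · exact absurd hab (hne a b h)
    · exact h
    · exact absurd hab.symm (hne b a h), fun n => by
    rw [hp]
    exact hadj _⟩
  obtain ⟨n, hn⟩ := ((hK n0).carries R).exists
  exact hn (p n).2.2.1

/-! ### Automorphisms -/

theorem image_bdry (φ : G ≃g G) (K : Set V) : G.bdry (φ '' K) = φ '' G.bdry K := by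
  ext v
  constructor
  · rintro ⟨hv, _, ⟨u, hu, rfl⟩, huv⟩
    obtain ⟨w, rfl⟩ := φ.surjective v
    exact ⟨w, ⟨fun h => hv ⟨w, h, rfl⟩, u, hu, φ.map_adj_iff.1 huv⟩, rfl⟩
  · rintro ⟨w, ⟨hw, u, hu, huw⟩, rfl⟩
    refine ⟨?_, φ u, ⟨u, hu, rfl⟩, φ.map_adj_iff.2 huw⟩
    rintro ⟨x, hx, hxw⟩
    exact hw (φ.injective hxw ▸ hx)

theorem image_clos (φ : G ≃g G) (K : Set V) : G.clos (φ '' K) = φ '' G.clos K := by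
  rw [clos, image_bdry, ← Set.image_union, clos]

theorem image_mul (φ ψ : G ≃g G) (K : Set V) : (φ * ψ) '' K = φ '' (ψ '' K) := by
  rw [← Set.image_comp]
  rfl

theorem image_one (K : Set V) : (1 : G ≃g G) '' K = K := Set.image_id K

theorem image_inv_image (φ : G ≃g G) (K : Set V) : (φ⁻¹ : G ≃g G) '' (φ '' K) = K := by
  rw [← image_mul, inv_mul_cancel, image_one]

theorem image_image_inv (φ : G ≃g G) (K : Set V) : φ '' ((φ⁻¹ : G ≃g G) '' K) = K := by
  rw [← image_mul, mul_inv_cancel, image_one]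

theorem image_compl_iso (φ : G ≃g G) (K : Set V) : φ '' Kᶜ = (φ '' K)ᶜ :=
  Set.image_compl_eq φ.bijective

theorem IsConn.image {K : Set V} (h : G.IsConn K) (φ : G ≃g G) : G.IsConn (φ '' K) := by
  refine ⟨h.1.image φ, fun P hP hne hcl => ?_⟩
  have hPe : φ '' (φ ⁻¹' P) = P := Set.image_preimage_eq P φ.surjective
  have := h.2 (φ ⁻¹' P) (fun v hv => by
    obtain ⟨w, hw, hwv⟩ := hP hv
    exact φ.injective hwv ▸ hw) (by
    obtain ⟨v, hv⟩ := hne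
    obtain ⟨w, rfl⟩ := φ.surjective v
    exact ⟨w, hv⟩) (fun a ha b hb hab =>
      hcl (φ a) ha (φ b) ⟨b, hb, rfl⟩ (φ.map_adj_iff.2 hab))
  rw [← this, hPe]

/-- The image of a ray under an automorphism. -/
def Ray.map (φ : G ≃g G) (R : G.Ray) : G.Ray :=
  ⟨fun n => φ (R.vert n), φ.injective.comp R.injective, fun n => φ.map_adj_iff.2 (R.adj n)⟩

theorem Carries.image {B : Set V} (h : G.Carries B) (φ : G ≃g G) : G.Carries (φ '' B) := by
  intro R
  refine (h (R.map φ⁻¹)).mono fun n hn => ⟨_, hn, ?_⟩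
  exact φ.apply_symm_apply _

theorem EndSep.image {A B : Set V} (h : G.EndSep A B) (φ : G ≃g G) :
    G.EndSep (φ '' A) (φ '' B) := by
  refine ⟨⟨fun v => ?_, ?_, ?_⟩, h.carries.image φ⟩
  · obtain ⟨w, rfl⟩ := φ.surjective v
    exact (h.cover w).imp (fun h => ⟨w, h, rfl⟩) (fun h => ⟨w, h, rfl⟩)
  · rintro _ ⟨a, ha, rfl⟩ _ ⟨b, hb, rfl⟩ h1 h2 h3
    exact h.no_adj a ha b hb (fun h => h1 ⟨a, h, rfl⟩) (fun h => h2 ⟨b, h, rfl⟩)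
      (φ.map_adj_iff.1 h3)
  · rw [← Set.image_inter φ.injective]
    exact h.finite.image φ

theorem Linked.image {X : Set V} (h : G.Linked k X) (φ : G ≃g G) : G.Linked k (φ '' X) := by
  intro A B hAB hX
  have h1 := hAB.image φ⁻¹
  have h2 : X ⊆ (φ⁻¹ : G ≃g G) '' A := by
    have := Set.image_mono (f := (φ⁻¹ : G ≃g G)) hX
    rwa [image_inv_image] at this
  have h3 := h _ _ h1 h2
  rwa [← Set.image_inter (RelIso.injective _), Set.ncard_image_of_injective _ (RelIso.injective _)]
    at h3

theorem Region.image {K : Set V} (h : G.Region k K) (φ : G ≃g G) : G.Region k (φ '' K) := by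
  refine ⟨h.isConn.image φ, ?_, ?_, ?_, ?_⟩
  · rw [image_bdry]
    exact h.finite_bdry.image φ
  · rw [image_bdry, Set.ncard_image_of_injective _ φ.injective, h.ncard_bdry]
  · rw [← image_compl_iso]
    exact h.carries.image φ
  · rw [image_clos]
    exact h.linked.image φ

theorem Cross.image {M N : Set V} (h : G.Cross M N) (φ : G ≃g G) :
    G.Cross (φ '' M) (φ '' N) := by
  rw [Cross, image_bdry, image_bdry, ← Set.image_inter φ.injective,
    ← Set.image_inter φ.injective]
  exact ⟨h.1.image φ, h.2.image φ⟩

theorem inter_clos_image {M N : Set V} (h : M ∩ G.clos N = ∅) (φ : G ≃g G) :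
    φ '' M ∩ G.clos (φ '' N) = ∅ := by
  rw [image_clos, ← Set.image_inter φ.injective, h, Set.image_empty]

/-- An automorphism cannot map a region properly into itself. -/
theorem Region.image_eq_of_subset (hG : G.ThinEnd k) {M : Set V} (hM : G.Region k M) {φ : G ≃g G}
    (h : φ '' M ⊆ M) : φ '' M = M := by
  by_contra hne
  have hlt : φ '' M ⊂ M := h.ssubset_of_ne hne
  refine hG.not_descending (fun n => (φ ^ n : G ≃g G) '' M) (fun n => hM.image _) fun n => ?_
  rw [pow_succ, image_mul]
  refine ⟨Set.image_mono h, fun h' => hlt.2 ?_⟩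
  exact (Set.image_subset_image_iff (RelIso.injective _)).1 h'

/-- Finitely many automorphisms fix a common region above any given one: the union of all translates
of a sufficiently large region that contain the given region. -/
theorem Region.exists_fixed (hG : G.ThinEnd k) {N : Set V} (hN : G.Region k N)
    {Φ : Set (G ≃g G)} (hΦ : Φ.Finite) : ∃ J, G.Region k J ∧ N ⊆ J ∧ ∀ φ ∈ Φ, φ '' J = J := by
  obtain ⟨J0, hJ0, -, hJ0s⟩ := hG.exists_region_of_finite
    (F := insert N ((fun φ : G ≃g G => φ '' N) '' Φ ∪ (fun φ : G ≃g G => (φ⁻¹ : G ≃g G) '' N) '' Φ))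
    (((hΦ.image _).union (hΦ.image _)).insert _) (by
      rintro K (rfl | ⟨φ, -, rfl⟩ | ⟨φ, -, rfl⟩)
      · exact hN
      · exact hN.image _
      · exact hN.image _) Set.finite_empty
  have hNJ : N ⊆ J0 := hJ0s N (Set.mem_insert _ _)
  -- The regions above `N` that do not contain `J0` lie properly below `M`, so that translates
  -- of `M` are not among them.
  have hex := hJ0.finite_not_superset hG hN.isConn.1 hNJ
  obtain ⟨M, hM, -, hMs⟩ := hG.exists_region_of_finite
    (hex.insert J0) (by
      rintro K (rfl | hK)
      · exact hJ0
      · exact hK.1) Set.finite_empty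
  have hJM : J0 ⊆ M := hMs J0 (Set.mem_insert _ _)
  let F : Set (Set V) := {R | N ⊆ R ∧ ∃ φ : G ≃g G, R = φ '' M}
  have hFJ : ∀ R ∈ F, J0 ⊆ R := by
    rintro R ⟨hNR, φ, rfl⟩
    by_contra hJR
    have h1 : φ '' M ⊆ M := hMs _ (Or.inr ⟨hM.image φ, hNR, hJR⟩)
    rw [hM.image_eq_of_subset hG h1] at hJR
    exact hJR hJM
  have hFfin : F.Finite := by
    refine ((hM.finite_not_superset hG hN.isConn.1 (hNJ.trans hJM)).insert M).subset ?_
    rintro R ⟨hNR, φ, rfl⟩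
    by_cases hMR : M ⊆ φ '' M
    · left
      have h1 : (φ⁻¹ : G ≃g G) '' M ⊆ M := by
        have := Set.image_mono (f := (φ⁻¹ : G ≃g G)) hMR
        rwa [image_inv_image] at this
      have h2 := hM.image_eq_of_subset hG h1
      conv_lhs => rw [← h2]
      exact image_image_inv φ M
    · exact Or.inr ⟨hM.image φ, hNR, hMR⟩
  have hMF : M ∈ F := ⟨hNJ.trans hJM, 1, (image_one M).symm⟩
  have hreg : ∀ F' : Set (Set V), F'.Finite → F' ⊆ F → G.Region k (M ∪ ⋃₀ F') := by
    intro F' hF'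
    induction F', hF' using Set.Finite.induction_on with
    | empty => exact fun _ => by simpa using hM
    | @insert R F' _ _ ih =>
      intro hsub
      have hR := hsub (Set.mem_insert _ _)
      have hR' : G.Region k R := by
        obtain ⟨-, φ, rfl⟩ := hR
        exact hM.image φ
      have := (ih ((Set.subset_insert _ _).trans hsub)).union_of_subset hR' hN
        ((hNJ.trans hJM).trans Set.subset_union_left) hR.1
      rwa [Set.union_assoc, Set.union_comm (⋃₀ F'), ← Set.sUnion_insert] at this
  have hU : M ∪ ⋃₀ F = ⋃₀ F := Set.union_eq_self_of_subset_left (Set.subset_sUnion_of_mem hMF)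
  have hJ := hreg F hFfin subset_rfl
  rw [hU] at hJ
  have hmap : ∀ φ : G ≃g G, (φ⁻¹ : G ≃g G) '' N ⊆ J0 → φ '' ⋃₀ F ⊆ ⋃₀ F := by
    intro φ hφ
    rw [Set.image_sUnion]
    apply Set.sUnion_subset
    rintro _ ⟨R, hR, rfl⟩
    refine Set.subset_sUnion_of_mem ⟨?_, ?_⟩
    · have := Set.image_mono (f := φ) (hφ.trans (hFJ R hR))
      rwa [image_image_inv] at this
    · obtain ⟨-, ψ, rfl⟩ := hR
      exact ⟨φ * ψ, (image_mul φ ψ M).symm⟩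
  refine ⟨⋃₀ F, hJ, (hNJ.trans hJM).trans (Set.subset_sUnion_of_mem hMF), fun φ hφ => ?_⟩
  apply Set.Subset.antisymm
  · exact hmap φ (hJ0s _ (Or.inr (Or.inr ⟨φ, hφ, rfl⟩)))
  · have := Set.image_mono (f := φ) (hmap φ⁻¹ (by
      rw [inv_inv]
      exact hJ0s _ (Or.inr (Or.inl ⟨φ, hφ, rfl⟩))))
    rwa [image_image_inv] at this

/-! ### Trimming a region -/

/-- `Core k K M`: the set `M` contains `K` and every region that crosses `K`. -/
def Core (G : SimpleGraph V) (k : ℕ) (K M : Set V) : Prop :=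
  K ⊆ M ∧ ∀ J, G.Region k J → G.Cross J K → J ⊆ M

/-- A deep region contains some region together with all regions that cross the latter. -/
def Deep (G : SimpleGraph V) (k : ℕ) (M : Set V) : Prop :=
  G.Region k M ∧ ∃ K, G.Region k K ∧ G.Core k K M

theorem Core.mono {K M N : Set V} (h : G.Core k K M) (hMN : M ⊆ N) : G.Core k K N :=
  ⟨h.1.trans hMN, fun J h1 h2 => (h.2 J h1 h2).trans hMN⟩

theorem Region.exists_core (hG : G.ThinEnd k) {K : Set V} (hK : G.Region k K) :
    ∃ M, G.Region k M ∧ G.Core k K M := by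
  obtain ⟨M, h1, -, h2⟩ := hG.exists_region_of_finite ((hK.finite_cross hG).insert K) (by
    rintro J (rfl | hJ)
    · exact hK
    · exact hJ.1) Set.finite_empty
  exact ⟨M, h1, h2 K (Set.mem_insert _ _), fun J h3 h4 => h2 J (Or.inr ⟨h3, h4.symm⟩)⟩

/-- A region that is not contained in `M` does not split the core of `M`. -/
theorem Core.subset_or_inter_clos {K M N : Set V} (h : G.Core k K M) (hK : G.Region k K)
    (hN : G.Region k N) (hNM : ¬ N ⊆ M) : K ⊆ N ∨ K ∩ G.clos N = ∅ := by
  rcases hK.isConn.nested_of_not_cross hN.isConn fun hc => hNM (h.2 N hN hc.symm) with h1 | h1 | h1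
  · exact Or.inl h1
  · exact absurd (h1.trans h.1) hNM
  · exact Or.inr h1

theorem Core.inter_clos_eq_empty {K M N : Set V} (h : G.Core k K M) (hK : G.Region k K)
    (hN : G.Region k N) (hNM : ¬ N ⊆ M) (hl : ¬ G.Linked k (G.clos M ∩ G.clos N)) :
    K ∩ G.clos N = ∅ :=
  (h.subset_or_inter_clos hK hN hNM).resolve_left fun h1 =>
    hl (hK.linked.mono (Set.subset_inter (clos_mono h.1) (clos_mono h1)))

/-- The small side of the separation obtained from the one of `M` by cutting off the members
of `F`. -/
def trimA (G : SimpleGraph V) (M : Set V) (F : Set (Set V)) : Set V := G.clos M \ ⋃₀ F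

/-- The side of the end of the separation obtained from the one of `M` by cutting off the members
of `F`. -/
def trimB (G : SimpleGraph V) (M : Set V) (F : Set (Set V)) : Set V := Mᶜ ∪ ⋃ X ∈ F, G.clos X

theorem mem_trim {M : Set V} {F : Set (Set V)} {v : V} :
    v ∈ G.trimA M F \ G.trimB M F ↔ v ∈ M ∧ ∀ X ∈ F, v ∉ G.clos X := by
  constructor
  · rintro ⟨-, h2⟩
    refine ⟨not_not.1 fun h => h2 (Or.inl h), fun X hX hv => h2 (Or.inr ?_)⟩
    exact Set.mem_biUnion hX hv
  · rintro ⟨h1, h2⟩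
    refine ⟨⟨Or.inl h1, ?_⟩, ?_⟩
    · rintro ⟨X, hX, hv⟩
      exact h2 X hX (Or.inl hv)
    · rintro (h | h)
      · exact h h1
      · obtain ⟨X, hX, hv⟩ := Set.mem_iUnion₂.1 h
        exact h2 X hX hv

/-- Cutting off regions `X` does not increase the order: each of them contains a region away from
`M`, so that the corner complementary to the one kept has order at least `k`. -/
theorem Region.endSep_trim {M : Set V} (hM : G.Region k M) {F : Set (Set V)} (hF : F.Finite)
    (hX : ∀ X ∈ F, G.Region k X ∧ ∃ L, G.Region k L ∧ L ⊆ X ∧ L ∩ G.clos M = ∅) :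
    G.EndSep (G.trimA M F) (G.trimB M F) ∧ (G.trimA M F ∩ G.trimB M F).ncard ≤ k := by
  induction F, hF using Set.Finite.induction_on with
  | empty =>
    simp only [trimA, trimB, Set.sUnion_empty, Set.sdiff_empty, Set.mem_empty_iff_false,
      Set.iUnion_of_empty, Set.iUnion_empty, Set.union_empty]
    exact ⟨hM.endSep, by rw [clos_inter_compl, hM.ncard_bdry]⟩
  | @insert X F _ _ ih =>
    obtain ⟨h1, h2⟩ := ih fun Y hY => hX Y (Or.inr hY)
    obtain ⟨hXr, L, hL, hLX, hLM⟩ := hX X (Set.mem_insert _ _)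
    have eA : G.trimA M (insert X F) = G.trimA M F ∩ Xᶜ := by
      rw [trimA, trimA, Set.sUnion_insert, Set.union_comm, ← Set.sdiff_sdiff, Set.sdiff_eq]
    have eB : G.trimB M (insert X F) = G.trimB M F ∪ G.clos X := by
      rw [trimB, trimB, Set.biUnion_insert, Set.union_assoc, Set.union_comm (G.clos X)]
    rw [eA, eB]
    refine ⟨h1.inter hXr.endSep.toFinSep.symm, ?_⟩
    -- The opposite corner has `L` on its small side, and hence order at least `k`.
    have h3 := h1.toFinSep.ncard_add_ncard hXr.endSep.toFinSep.symm
    have h4 : G.EndSep (G.trimB M F ∩ G.clos X) (G.trimA M F ∪ Xᶜ) :=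
      ⟨h1.toFinSep.symm.inter hXr.endSep.toFinSep, hXr.carries.mono Set.subset_union_right⟩
    have h5 := hL.linked _ _ h4 (Set.subset_inter (fun v hv => Or.inl fun hvM =>
      Set.eq_empty_iff_forall_notMem.1 (clos_inter_eq_empty (M := L) (N := M) hLM) v ⟨hv, hvM⟩)
      (clos_mono hLX))
    rw [Set.inter_comm] at h5
    rw [Set.inter_comm Xᶜ, clos_inter_compl, hXr.ncard_bdry] at h3
    omega

/-- A region `M` can be trimmed by regions `X` to a region `R` that no longer touches them and still
contains a given region `K` apart from them. -/
theorem Region.exists_trim {M K : Set V} (hM : G.Region k M) (hK : G.Region k K) (hKM : K ⊆ M)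
    {F : Set (Set V)} (hF : F.Finite) (hX : ∀ X ∈ F, G.Region k X ∧ K ∩ G.clos X = ∅ ∧
      ∃ L, G.Region k L ∧ L ⊆ X ∧ L ∩ G.clos M = ∅) :
    ∃ R, G.Region k R ∧ K ⊆ R ∧ R ⊆ M ∧ (∀ X ∈ F, R ∩ G.clos X = ∅) ∧
      G.bdry R = G.trimA M F ∩ G.trimB M F := by
  obtain ⟨h1, h2⟩ := hM.endSep_trim hF fun X h => ⟨(hX X h).1, (hX X h).2.2⟩
  have hsub : K ⊆ G.trimA M F \ G.trimB M F := fun v hv => mem_trim.2 ⟨hKM hv, fun X h hvX =>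
    Set.eq_empty_iff_forall_notMem.1 (hX X h).2.1 v ⟨hv, hvX⟩⟩
  obtain ⟨x, hx⟩ := hK.isConn.1
  obtain ⟨h3, h4⟩ := region_compIn h1 h2 hK.isConn hsub hK.linked hx
  have hR := compIn_subset (G := G) (hsub hx)
  refine ⟨_, h3, hK.isConn.subset_compIn hsub hx, fun v hv => (mem_trim.1 (hR hv)).1,
    fun X h => ?_, h4⟩
  rw [Set.eq_empty_iff_forall_notMem]
  exact fun v hv => (mem_trim.1 (hR hv.1)).2 X h hv.2

/-- A set inside `M` that stays away from `F` does not cross a component of the trimmed set. -/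
theorem not_cross_of_bdry_eq_trim {M R s : Set V} {F : Set (Set V)}
    (hR : G.bdry R = G.trimA M F ∩ G.trimB M F) (hs : s ⊆ M) (hX : ∀ X ∈ F, s ∩ G.clos X = ∅) :
    ¬ G.Cross s R := by
  rintro ⟨⟨v, hv, hvR⟩, -⟩
  rw [hR] at hvR
  refine (mem_trim (G := G).2 ⟨hs hv, fun X h hvX => ?_⟩).2 hvR.2
  exact Set.eq_empty_iff_forall_notMem.1 (hX X h) v ⟨hv, hvX⟩

theorem not_cross_sUnion {J : Set V} (hJ : G.IsConn J) {F : Set (Set V)}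
    (hF : ∀ X ∈ F, G.IsConn X ∧ ¬ G.Cross J X) : ¬ G.Cross J (⋃₀ F) := by
  rintro ⟨h1, v, ⟨X, hX, hvX⟩, hv⟩
  rcases hJ.nested_of_not_cross (hF X hX).1 (hF X hX).2 with h | h | h
  · rw [inter_bdry_eq_empty_of_subset (h.trans (Set.subset_sUnion_of_mem hX))] at h1
    exact h1.ne_empty rfl
  · exact hv.1 (h hvX)
  · exact Set.eq_empty_iff_forall_notMem.1 (inter_clos_eq_empty_symm h) v ⟨hvX, Or.inr hv⟩

theorem Region.nested {M N : Set V} (hM : G.Region k M) (hN : G.Region k N)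
    (h : ¬ G.Cross M N) : M ⊆ N ∨ N ⊆ M ∨ M ∩ G.clos N = ∅ :=
  hM.isConn.nested_of_not_cross hN.isConn h

/-! ### Extending a nested family -/

/-- Above any region there is one that is nested with a given nested family `S` of deep regions. If
a member `s` of `S` crosses `N`, then either `N ∪ s` is a region or `N` can be trimmed by `s`; both
operations lower the number of members of `S` that are crossed. -/
theorem exists_region_not_cross (hG : G.ThinEnd k) {S : Set (Set V)} (hS : ∀ s ∈ S, G.Deep k s)
    (hn : ∀ s ∈ S, ∀ t ∈ S, ¬ G.Cross s t) {K : Set V} (hK : G.Region k K) :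
    ∃ N, G.Region k N ∧ K ⊆ N ∧ ∀ s ∈ S, ¬ G.Cross s N := by
  obtain ⟨N0, hN0, hK0⟩ := hK.exists_core hG
  suffices ∀ (n : ℕ) (N : Set V), G.Region k N → K ⊆ N → (∀ s ∈ S, G.Cross s N → G.Cross s N0) →
      {s | s ∈ S ∧ G.Cross s N}.ncard = n → ∃ N, G.Region k N ∧ K ⊆ N ∧ ∀ s ∈ S, ¬ G.Cross s N from
    this _ N0 hN0 hK0.1 (fun _ _ h => h) rfl
  intro n
  induction n using Nat.strong_induction_on with
  | _ n ih =>
  intro N hN hKN hNN0 hcard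
  by_cases hex : ∃ s ∈ S, G.Cross s N
  swap
  · push Not at hex
    exact ⟨N, hN, hKN, hex⟩
  obtain ⟨s, hs, hsN⟩ := hex
  have hfin : {s | s ∈ S ∧ G.Cross s N}.Finite :=
    (hN.finite_cross hG).subset fun t ht => ⟨(hS t ht.1).1, ht.2.symm⟩
  have hsr := (hS s hs).1
  suffices ∃ N', G.Region k N' ∧ K ⊆ N' ∧ ¬ G.Cross s N' ∧
      ∀ t ∈ S, G.Cross t N' → G.Cross t N by
    obtain ⟨N', h1, h2, h3, h4⟩ := this
    refine ih _ ?_ N' h1 h2 (fun t ht htN => hNN0 t ht (h4 t ht htN)) rfl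
    rw [← hcard]
    refine Set.ncard_lt_ncard ⟨fun t ht => ⟨ht.1, h4 t ht.1 ht.2⟩, fun hsub => ?_⟩ hfin
    exact h3 (hsub ⟨hs, hsN⟩).2
  by_cases hl : G.Linked k (G.clos N ∩ G.clos s)
  · refine ⟨N ∪ s, hN.union hsr hsN.symm.touch hl, hKN.trans Set.subset_union_left,
      not_cross_of_subset Set.subset_union_right, fun t ht htN => ?_⟩
    by_contra hcon
    rw [← Set.sUnion_pair] at htN
    refine not_cross_sUnion (hS t ht).1.isConn ?_ htN
    rintro X (rfl | rfl)
    · exact ⟨hN.isConn, hcon⟩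
    · exact ⟨hsr.isConn, hn t ht _ hs⟩
  · have hsN0 : ¬ s ⊆ N0 := fun h => not_cross_of_subset h (hNN0 s hs hsN)
    have hKs : K ∩ G.clos s = ∅ :=
      (hK0.subset_or_inter_clos hK hsr hsN0).resolve_left fun h =>
        hl (hK.linked.mono (Set.subset_inter (clos_mono hKN) (clos_mono h)))
    obtain ⟨-, L, hL, hLs⟩ := hS s hs
    have hLN : L ∩ G.clos N = ∅ := hLs.inter_clos_eq_empty hL hN
      (fun h => not_cross_of_superset h hsN) (by rwa [Set.inter_comm])
    obtain ⟨R, hR, hKR, hRN, hRs, hRb⟩ := hN.exists_trim hK hKN (Set.finite_singleton s) (by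
      rintro X rfl
      exact ⟨hsr, hKs, L, hL, hLs.1, hLN⟩)
    have hRs' := hRs s rfl
    refine ⟨R, hR, hKR, fun h => not_cross_of_inter_clos hRs' h.symm, fun t ht htR => ?_⟩
    by_contra hcon
    rcases (hS t ht).1.nested hN hcon with h | h | h
    · rcases (hS t ht).1.nested hsr (hn t ht s hs) with h' | h' | h'
      · obtain ⟨v, hv, hvt⟩ := htR.2
        exact Set.eq_empty_iff_forall_notMem.1 hRs' v ⟨hv, clos_mono h' (Or.inr hvt)⟩
      · exact not_cross_of_subset (h'.trans h) hsN
      · refine not_cross_of_bdry_eq_trim hRb h ?_ htR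
        rintro X rfl
        exact h'
    · exact not_cross_of_superset (hRN.trans h) htR
    · refine not_cross_of_inter_clos (Set.eq_empty_iff_forall_notMem.2 fun v hv => ?_) htR
      exact Set.eq_empty_iff_forall_notMem.1 h v ⟨hv.1, clos_mono hRN hv.2⟩

theorem Region.image_eq_image_of_subset (hG : G.ThinEnd k) {N : Set V} (hN : G.Region k N)
    {φ ψ : G ≃g G} (h : φ '' N ⊆ ψ '' N) : φ '' N = ψ '' N := by
  have h1 : (ψ⁻¹ * φ : G ≃g G) '' N ⊆ N := by
    have := Set.image_mono (f := (ψ⁻¹ : G ≃g G)) h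
    rwa [image_inv_image, ← image_mul] at this
  have h2 := congrArg (fun X => ψ '' X) (hN.image_eq_of_subset hG h1)
  simp only [image_mul, image_image_inv] at h2
  exact h2

/-- `M` is a union of translates of `N`. -/
def IsTranslateUnion (G : SimpleGraph V) (N M : Set V) : Prop :=
  ∀ v ∈ M, ∃ φ : G ≃g G, v ∈ φ '' N ∧ φ '' N ⊆ M

theorem IsTranslateUnion.image {N M : Set V} (h : G.IsTranslateUnion N M) (φ : G ≃g G) :
    G.IsTranslateUnion N (φ '' M) := by
  rintro _ ⟨v, hv, rfl⟩
  obtain ⟨ψ, h1, h2⟩ := h v hv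
  refine ⟨φ * ψ, ?_, ?_⟩
  · rw [image_mul]
    exact ⟨v, h1, rfl⟩
  · rw [image_mul]
    exact Set.image_mono h2

/-- The regions above `N` that are unions of translates of `N` are bounded: they lie in any region
above `N` fixed by finitely many automorphisms that represent all translates crossing `N`. -/
theorem Region.exists_bound_translates (hG : G.ThinEnd k) {N : Set V} (hN : G.Region k N) :
    ∃ J, G.Region k J ∧ N ⊆ J ∧ ∀ M, G.IsConn M → N ⊆ M → G.IsTranslateUnion N M → M ⊆ J := by
  let F : Set (Set V) := {X | G.Cross N X ∧ ∃ φ : G ≃g G, X = φ '' N}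
  have hF : F.Finite := (hN.finite_cross hG).subset (by
    rintro _ ⟨h1, φ, rfl⟩
    exact ⟨hN.image φ, h1⟩)
  have hrep : ∀ X ∈ F, ∃ φ : G ≃g G, X = φ '' N := fun X h => h.2
  choose! f hf using hrep
  obtain ⟨J, hJ, hNJ, hfix⟩ := hN.exists_fixed hG (hF.image f)
  refine ⟨J, hJ, hNJ, fun M hM hNM hTr => ?_⟩
  -- The part of `M` covered by translates `h '' N ⊆ M` with `h '' J = J` is closed under adjacency:
  -- the translates at adjacent vertices are equal or cross, and in the latter case they differ by
  -- one of the automorphisms that fix `J`.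
  have key := hM.2 {v | v ∈ M ∧ ∃ h : G ≃g G, h '' J = J ∧ v ∈ h '' N ∧ h '' N ⊆ M}
    (fun v hv => hv.1) (by
      obtain ⟨x, hx⟩ := hN.isConn.1
      exact ⟨x, hNM hx, 1, image_one J, by rwa [image_one], by rwa [image_one]⟩) (by
      rintro a ⟨-, h, hJ', ha, hNa⟩ b hb hab
      refine ⟨hb, ?_⟩
      obtain ⟨φ, hbφ, hφM⟩ := hTr b hb
      by_cases hc : G.Cross (h '' N) (φ '' N)
      · have hc' : G.Cross N ((h⁻¹ * φ : G ≃g G) '' N) := by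
          have := hc.image h⁻¹
          rwa [image_inv_image, ← image_mul] at this
        have hmem : (h⁻¹ * φ : G ≃g G) '' N ∈ F := ⟨hc', _, rfl⟩
        have h1 := hf _ hmem
        have h2 := hfix _ ⟨_, hmem, rfl⟩
        set ψ := f ((h⁻¹ * φ : G ≃g G) '' N)
        have h3 : φ '' N = (h * ψ : G ≃g G) '' N := by
          rw [image_mul, ← h1, image_mul, image_image_inv]
        refine ⟨h * ψ, by rw [image_mul, h2, hJ'], ?_, ?_⟩
        · rwa [← h3]
        · rwa [← h3]
      · have heq : h '' N = φ '' N := by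
          rcases (hN.image h).nested (hN.image φ) hc with h1 | h1 | h1
          · exact hN.image_eq_image_of_subset hG h1
          · exact (hN.image_eq_image_of_subset hG h1).symm
          · exact absurd ⟨ha, mem_clos_of_adj hbφ hab.symm⟩
              (Set.eq_empty_iff_forall_notMem.1 h1 a)
        exact ⟨h, hJ', by rwa [heq], hNa⟩)
  intro v hv
  obtain ⟨-, h, hJ', hvh, -⟩ := key.symm.subset hv
  rw [← hJ']
  exact Set.image_mono hNJ hvh

/-- Among the regions above `N` that are unions of translates of `N`, a maximal one is nested with
each of its translates, or crosses it with an intersection that is not linked. -/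
theorem Region.exists_maximal_translates (hG : G.ThinEnd k) {N : Set V} (hN : G.Region k N) :
    ∃ M, G.Region k M ∧ N ⊆ M ∧ G.IsTranslateUnion N M ∧ ∀ φ : G ≃g G, φ '' M = M ∨
      M ∩ G.clos (φ '' M) = ∅ ∨
      (G.Cross M (φ '' M) ∧ ¬ G.Linked k (G.clos M ∩ G.clos (φ '' M))) := by
  obtain ⟨J, hJ, hNJ, hbd⟩ := hN.exists_bound_translates hG
  let B : Set (Set V) := {M | G.Region k M ∧ N ⊆ M ∧ G.IsTranslateUnion N M}
  have hB : B.Finite := (hJ.finite_between hG hN.isConn.1 hNJ).subset fun M hM =>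
    ⟨hM.1, hM.2.1, hbd M hM.1.isConn hM.2.1 hM.2.2⟩
  have hNB : N ∈ B := ⟨hN, subset_rfl, fun v hv => ⟨1, by rwa [image_one], by rw [image_one]⟩⟩
  obtain ⟨M, hMB, hmax⟩ := hB.exists_maximal ⟨N, hNB⟩
  refine ⟨M, hMB.1, hMB.2.1, hMB.2.2, fun φ => ?_⟩
  have hφM := hMB.1.image φ
  have hφT := hMB.2.2.image φ
  by_cases hc : G.Cross M (φ '' M)
  · refine Or.inr (Or.inr ⟨hc, fun hl => ?_⟩)
    have hU : M ∪ φ '' M ∈ B := by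
      refine ⟨hMB.1.union hφM hc.touch hl, hMB.2.1.trans Set.subset_union_left, ?_⟩
      rintro v (hv | hv)
      · obtain ⟨ψ, h1, h2⟩ := hMB.2.2 v hv
        exact ⟨ψ, h1, h2.trans Set.subset_union_left⟩
      · obtain ⟨ψ, h1, h2⟩ := hφT v hv
        exact ⟨ψ, h1, h2.trans Set.subset_union_right⟩
    exact not_cross_of_superset (Set.subset_union_right.trans (hmax hU Set.subset_union_left)) hc
  · rcases hMB.1.nested hφM hc with h | h | h
    · exact Or.inl ((hmax ⟨hφM, hMB.2.1.trans h, hφT⟩ h).antisymm h)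
    · exact Or.inl (hMB.1.image_eq_of_subset hG h)
    · exact Or.inr (Or.inl h)

theorem image_trimA (φ : G ≃g G) (M : Set V) (F : Set (Set V)) :
    φ '' G.trimA M F = G.trimA (φ '' M) ((fun X => φ '' X) '' F) := by
  rw [trimA, trimA, Set.image_sdiff φ.injective, image_clos, Set.image_sUnion]

theorem image_trimB (φ : G ≃g G) (M : Set V) (F : Set (Set V)) :
    φ '' G.trimB M F = G.trimB (φ '' M) ((fun X => φ '' X) '' F) := by
  rw [trimB, trimB, Set.image_union, image_compl_iso, Set.image_iUnion₂, Set.biUnion_image]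
  simp only [image_clos]

/-- Above any region there is a deep region whose orbit is nested and nested with a given invariant
nested family `S` of deep regions: start with a region nested with `S`, merge it with translates as
long as this gives regions, and trim the result by the translates that still cross it. -/
theorem exists_deep_nested_orbit (hG : G.ThinEnd k) {S : Set (Set V)}
    (hS : ∀ s ∈ S, G.Deep k s) (hinv : ∀ φ : G ≃g G, ∀ s ∈ S, φ '' s ∈ S)
    (hn : ∀ s ∈ S, ∀ t ∈ S, ¬ G.Cross s t) {K : Set V} (hK : G.Region k K) :
    ∃ R, G.Deep k R ∧ K ⊆ R ∧ (∀ s ∈ S, ¬ G.Cross s R) ∧ ∀ φ : G ≃g G, ¬ G.Cross R (φ '' R) := by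
  obtain ⟨K0, hK0, hKK0⟩ := hK.exists_core hG
  obtain ⟨K1, hK1, hK01⟩ := hK0.exists_core hG
  obtain ⟨N, hN, hK1N, hSN⟩ := exists_region_not_cross hG hS hn hK1
  obtain ⟨M, hM, hNM, hTr, hMφ⟩ := hN.exists_maximal_translates hG
  have hcore : G.Core k K0 M := hK01.mono (hK1N.trans hNM)
  -- The translates of `M` that still cross `M`. They do not touch `K0`, so that `M` can be trimmed
  -- by all of them at once.
  let F : Set (Set V) := {X | (∃ φ : G ≃g G, X = φ '' M) ∧ G.Cross M X ∧
    ¬ G.Linked k (G.clos M ∩ G.clos X)}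
  have hF : F.Finite := (hM.finite_cross hG).subset (by
    rintro _ ⟨⟨φ, rfl⟩, h, -⟩
    exact ⟨hM.image φ, h⟩)
  obtain ⟨R, hR, hK0R, hRM, hRF, hRb⟩ := hM.exists_trim hK0 hcore.1 hF (by
    rintro _ ⟨⟨φ, rfl⟩, hc, hl⟩
    have h1 : K0 ∩ G.clos (φ '' M) = ∅ := hcore.inter_clos_eq_empty hK0 (hM.image φ)
      (not_cross_of_superset · hc) hl
    refine ⟨hM.image φ, h1, φ '' K0, hK0.image φ, Set.image_mono hcore.1, ?_⟩
    -- The situation is symmetric: apply the inverse of `φ`.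
    have h2 : G.Cross M ((φ⁻¹ : G ≃g G) '' M) := by
      have := hc.image φ⁻¹
      rw [image_inv_image] at this
      exact this.symm
    have h3 : ¬ G.Linked k (G.clos M ∩ G.clos ((φ⁻¹ : G ≃g G) '' M)) := fun h => by
      have := h.image φ
      rw [Set.image_inter φ.injective, ← image_clos, ← image_clos, image_image_inv,
        Set.inter_comm] at this
      exact hl this
    have h4 := inter_clos_image (hcore.inter_clos_eq_empty hK0 (hM.image φ⁻¹)
      (not_cross_of_superset · h2) h3) φ
    rwa [image_image_inv] at h4)
  have hSM : ∀ s ∈ S, ¬ G.Cross s M := by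
    intro s hs
    have hMU : M = ⋃₀ {X | X ⊆ M ∧ ∃ φ : G ≃g G, X = φ '' N} := by
      apply Set.Subset.antisymm
      · intro v hv
        obtain ⟨φ, h1, h2⟩ := hTr v hv
        exact ⟨φ '' N, ⟨h2, φ, rfl⟩, h1⟩
      · exact Set.sUnion_subset fun X hX => hX.1
    rw [hMU]
    refine not_cross_sUnion (hS s hs).1.isConn ?_
    rintro _ ⟨-, φ, rfl⟩
    refine ⟨(hN.image φ).isConn, fun hc => ?_⟩
    have := hc.image φ⁻¹
    rw [image_inv_image] at this
    exact hSN _ (hinv φ⁻¹ s hs) this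
  refine ⟨R, ⟨hR, K, hK, hKK0.mono hK0R⟩, hKK0.1.trans hK0R, fun s hs => ?_, fun φ => ?_⟩
  · have hsr := (hS s hs).1
    rcases hsr.nested hM (hSM s hs) with h | h | h
    · refine not_cross_of_bdry_eq_trim hRb h ?_
      rintro _ ⟨⟨φ, rfl⟩, hc, hl⟩
      have hsφ : ¬ G.Cross s (φ '' M) := fun hc' => by
        have := hc'.image φ⁻¹
        rw [image_inv_image] at this
        exact hSM _ (hinv φ⁻¹ s hs) this
      rcases hsr.nested (hM.image φ) hsφ with h' | h' | h'
      · exact absurd (hsr.linked.mono (Set.subset_inter (clos_mono h) (clos_mono h'))) hl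
      · exact absurd hc (not_cross_of_superset (h'.trans h))
      · exact h'
    · exact not_cross_of_superset (hRM.trans h)
    · refine not_cross_of_inter_clos (Set.eq_empty_iff_forall_notMem.2 fun v hv => ?_)
      exact Set.eq_empty_iff_forall_notMem.1 h v ⟨hv.1, clos_mono hRM hv.2⟩
  · have hφR : G.clos (φ '' R) ⊆ G.clos (φ '' M) := clos_mono (Set.image_mono hRM)
    rcases hMφ φ with h | h | h
    · -- `φ` permutes the translates that cross `M`, so `R` and its image have the same boundary.
      have hFφ : ∀ ψ : G ≃g G, ψ '' M = M → ∀ X ∈ F, ψ '' X ∈ F := by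
        rintro ψ hψ _ ⟨⟨θ, rfl⟩, hc, hl⟩
        refine ⟨⟨ψ * θ, (image_mul ψ θ M).symm⟩, ?_, fun hl' => hl ?_⟩
        · have := hc.image ψ
          rwa [hψ] at this
        · have := hl'.image ψ⁻¹
          rw [Set.image_inter (RelIso.injective _), ← image_clos, ← image_clos,
            image_inv_image] at this
          have hψ' : (ψ⁻¹ : G ≃g G) '' M = M := by
            conv_lhs => rw [← hψ]
            exact image_inv_image ψ M
          rwa [hψ'] at this
      have h' : (φ⁻¹ : G ≃g G) '' M = M := by
        conv_lhs => rw [← h]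
        exact image_inv_image φ M
      have hFF : (fun X => φ '' X) '' F = F := by
        apply Set.Subset.antisymm
        · rintro _ ⟨X, hX, rfl⟩
          exact hFφ φ h X hX
        · exact fun X hX => ⟨_, hFφ φ⁻¹ h' X hX, image_image_inv φ X⟩
      have hb : G.bdry (φ '' R) = G.bdry R := by
        rw [image_bdry, hRb, Set.image_inter φ.injective, image_trimA, image_trimB, h, hFF]
      rintro ⟨⟨v, hv, hv'⟩, -⟩
      rw [hb] at hv'
      exact hv'.1 hv
    · refine not_cross_of_inter_clos (Set.eq_empty_iff_forall_notMem.2 fun v hv => ?_)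
      exact Set.eq_empty_iff_forall_notMem.1 h v ⟨hRM hv.1, hφR hv.2⟩
    · refine not_cross_of_inter_clos (Set.eq_empty_iff_forall_notMem.2 fun v hv => ?_)
      exact Set.eq_empty_iff_forall_notMem.1 (hRF _ ⟨⟨φ, rfl⟩, h⟩) v ⟨hv.1, hφR hv.2⟩

/-- There is an invariant nested family of regions that contains regions above any given one: a
maximal invariant nested family of deep regions. -/
theorem ThinEnd.exists_nested_family (hG : G.ThinEnd k) : ∃ S : Set (Set V),
    (∀ s ∈ S, G.Region k s) ∧ (∀ φ : G ≃g G, ∀ s ∈ S, φ '' s ∈ S) ∧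
      (∀ s ∈ S, ∀ t ∈ S, ¬ G.Cross s t) ∧ ∀ K, G.Region k K → ∃ s ∈ S, K ⊆ s := by
  obtain ⟨S, ⟨hS, hinv, hn⟩, hmax⟩ := zorn_subset {S : Set (Set V) | (∀ s ∈ S, G.Deep k s) ∧
      (∀ φ : G ≃g G, ∀ s ∈ S, φ '' s ∈ S) ∧ ∀ s ∈ S, ∀ t ∈ S, ¬ G.Cross s t} (by
    intro c hc hchain
    refine ⟨⋃₀ c, ⟨?_, ?_, ?_⟩, fun s hs => Set.subset_sUnion_of_mem hs⟩
    · rintro s ⟨X, hX, hs⟩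
      exact (hc hX).1 s hs
    · rintro φ s ⟨X, hX, hs⟩
      exact ⟨X, hX, (hc hX).2.1 φ s hs⟩
    · rintro s ⟨X, hX, hs⟩ t ⟨Y, hY, ht⟩
      rcases hchain.total hX hY with h | h
      · exact (hc hY).2.2 s (h hs) t ht
      · exact (hc hX).2.2 s hs t (h ht))
  refine ⟨S, fun s hs => (hS s hs).1, hinv, hn, fun K hK => ?_⟩
  obtain ⟨R, ⟨hR, L, hL, hcore⟩, hKR, hSR, hRφ⟩ := exists_deep_nested_orbit hG hS hinv hn hK
  refine ⟨R, hmax (y := S ∪ {X | ∃ φ : G ≃g G, X = φ '' R}) ⟨?_, ?_, ?_⟩ Set.subset_union_left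
    (Or.inr ⟨1, (image_one R).symm⟩), hKR⟩
  · rintro s (hs | ⟨φ, rfl⟩)
    · exact hS s hs
    · refine ⟨hR.image φ, φ '' L, hL.image φ, Set.image_mono hcore.1, fun J hJ hc => ?_⟩
      have h1 := hc.image φ⁻¹
      rw [image_inv_image] at h1
      have h2 := Set.image_mono (f := φ) (hcore.2 _ (hJ.image φ⁻¹) h1)
      rwa [image_image_inv] at h2
  · rintro φ s (hs | ⟨ψ, rfl⟩)
    · exact Or.inl (hinv φ s hs)
    · exact Or.inr ⟨φ * ψ, (image_mul φ ψ R).symm⟩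
  · have hSφ : ∀ s ∈ S, ∀ φ : G ≃g G, ¬ G.Cross s (φ '' R) := fun s hs φ hc => by
      have := hc.image φ⁻¹
      rw [image_inv_image] at this
      exact hSR _ (hinv φ⁻¹ s hs) this
    rintro s (hs | ⟨φ, rfl⟩) t (ht | ⟨ψ, rfl⟩)
    · exact hn s hs t ht
    · exact hSφ s hs ψ
    · exact fun hc => hSφ t ht φ hc.symm
    · intro hc
      have := hc.image φ⁻¹
      rw [image_inv_image, ← image_mul] at this
      exact hRφ _ this

/-! ### The tree of a poset with parents -/

section Parent

variable {W : Type u} [PartialOrder W]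

/-- `p a` is the least element above `a`. -/
def IsParentMap (p : W → W) : Prop := ∀ a, a < p a ∧ ∀ b, a < b → p a ≤ b

/-- The graph in which every element is joined to its parent. -/
def parentGraph (p : W → W) : SimpleGraph W := SimpleGraph.fromRel fun a b => p a = b

theorem exists_isParentMap (hchain : ∀ a b c : W, a ≤ b → a ≤ c → b ≤ c ∨ c ≤ b)
    (hfin : ∀ a b : W, (Set.Icc a b).Finite) (hup : ∀ a : W, ∃ b, a < b) :
    ∃ p : W → W, IsParentMap p := by
  have : ∀ a : W, ∃ m, a < m ∧ ∀ b, a < b → m ≤ b := by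
    intro a
    obtain ⟨c, hc⟩ := hup a
    obtain ⟨m, hm, hmin⟩ := ((hfin a c).subset Set.Ioc_subset_Icc_self).exists_minimal
      ⟨c, hc, le_rfl⟩
    refine ⟨m, hm.1, fun b hb => ?_⟩
    rcases hchain a m b hm.1.le hb.le with h | h
    · exact h
    · exact hmin ⟨hb, h.trans hm.2⟩ h
  choose p hp using this
  exact ⟨p, hp⟩

variable {p : W → W}

theorem IsParentMap.adj_iff (hp : IsParentMap p) {a b : W} :
    (parentGraph p).Adj a b ↔ p a = b ∨ p b = a := by
  rw [parentGraph, fromRel_adj, and_iff_right_iff_imp]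
  rintro (rfl | rfl)
  · exact (hp a).1.ne
  · exact (hp b).1.ne'

theorem IsParentMap.exists_iterate (hp : IsParentMap p) (hfin : ∀ a b : W, (Set.Icc a b).Finite)
    {a b : W} (hab : a ≤ b) : ∃ n, p^[n] a = b := by
  induction hn : (Set.Icc a b).ncard using Nat.strong_induction_on generalizing a with
  | _ n ih =>
    rcases hab.eq_or_lt with rfl | hlt
    · exact ⟨0, rfl⟩
    · have hss : Set.Icc (p a) b ⊂ Set.Icc a b :=
        ⟨Set.Icc_subset_Icc_left (hp a).1.le, fun h => (h ⟨le_rfl, hab⟩).1.not_gt (hp a).1⟩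
      obtain ⟨m, hm⟩ := ih _ (hn ▸ Set.ncard_lt_ncard hss (hfin a b)) ((hp a).2 b hlt) rfl
      exact ⟨m + 1, hm⟩

theorem IsParentMap.reachable_iterate (hp : IsParentMap p) (a : W) (n : ℕ) :
    (parentGraph p).Reachable a (p^[n] a) := by
  induction n with
  | zero => exact Reachable.refl _
  | succ n ih =>
    rw [Function.iterate_succ_apply']
    exact ih.trans (Adj.reachable (hp.adj_iff.2 (Or.inl rfl)))

theorem IsParentMap.isTree [Nonempty W] (hp : IsParentMap p)
    (hfin : ∀ a b : W, (Set.Icc a b).Finite) (hdir : ∀ a b : W, ∃ c, a ≤ c ∧ b ≤ c) :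
    (parentGraph p).IsTree := by
  refine ⟨⟨fun a b => ?_⟩, ?_⟩
  · obtain ⟨c, hac, hbc⟩ := hdir a b
    obtain ⟨m, hm⟩ := hp.exists_iterate hfin hac
    obtain ⟨n, hn⟩ := hp.exists_iterate hfin hbc
    have h1 := hp.reachable_iterate a m
    have h2 := hp.reachable_iterate b n
    rw [hm] at h1
    rw [hn] at h2
    exact h1.trans h2.symm
  · -- The edge from `a` to its parent is the only one leaving the set of elements below `a`.
    have key : ∀ a, (parentGraph p).IsBridge s(a, p a) := by
      intro a
      rw [isBridge_iff]
      rintro ⟨w⟩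
      have : ∀ (x y : W), ((parentGraph p).deleteEdges {s(a, p a)}).Walk x y → x ≤ a → y ≤ a := by
        intro x y w
        induction w with
        | nil => exact id
        | @cons x z y h _ ih =>
          intro hx
          apply ih
          rw [deleteEdges_adj] at h
          rcases hp.adj_iff.1 h.1 with h1 | h1
          · subst h1
            rcases hx.eq_or_lt with rfl | hlt
            · exact absurd rfl h.2
            · exact (hp x).2 a hlt
          · rw [← h1] at hx
            exact (hp z).1.le.trans hx
      exact (this _ _ w le_rfl).not_gt (hp a).1
    rw [isAcyclic_iff_forall_adj_isBridge]
    intro a b hab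
    rcases hp.adj_iff.1 hab with rfl | rfl
    · exact key a
    · rw [Sym2.eq_swap]
      exact key b

/-- Without infinite descending sequences every ray follows the parent map. -/
theorem IsParentMap.ray_vert (hp : IsParentMap p) (hwf : ∀ f : ℕ → W, ¬ ∀ n, f (n + 1) < f n)
    (R : (parentGraph p).Ray) (n : ℕ) : R.vert n = p^[n] (R.vert 0) := by
  have hstep : ∀ n, p (R.vert n) = R.vert (n + 1) := by
    intro n
    by_contra hne
    have hdown : ∀ m, p (R.vert (n + m + 1)) = R.vert (n + m) := by
      intro m
      induction m with
      | zero => exact (hp.adj_iff.1 (R.adj n)).resolve_left hne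
      | succ m ih =>
        refine (hp.adj_iff.1 (R.adj (n + m + 1))).resolve_left fun h => ?_
        have := R.injective (ih.symm.trans h)
        omega
    refine hwf (fun m => R.vert (n + m)) fun m => ?_
    change R.vert (n + m + 1) < R.vert (n + m)
    rw [← hdown m]
    exact (hp _).1
  induction n with
  | zero => rfl
  | succ n ih => rw [← hstep, ih, Function.iterate_succ_apply']

theorem IsParentMap.isOneEnded [Nonempty W] (hp : IsParentMap p)
    (hfin : ∀ a b : W, (Set.Icc a b).Finite) (hdir : ∀ a b : W, ∃ c, a ≤ c ∧ b ≤ c)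
    (hwf : ∀ f : ℕ → W, ¬ ∀ n, f (n + 1) < f n) : (parentGraph p).IsOneEnded := by
  obtain ⟨a⟩ := ‹Nonempty W›
  have hmono : StrictMono fun n => p^[n] a := strictMono_nat_of_lt_succ fun n => by
    rw [Function.iterate_succ_apply']
    exact (hp _).1
  let R : (parentGraph p).Ray := ⟨fun n => p^[n] a, hmono.injective, fun n => by
    rw [Function.iterate_succ_apply']
    exact hp.adj_iff.2 (Or.inl rfl)⟩
  refine ⟨R.toEnd, fun η => ?_⟩
  induction η using Quotient.inductionOn with
  | h R' =>
  refine Quotient.sound (s := (parentGraph p).raySetoid) (?_ : R'.SameEnd R)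
  obtain ⟨c, h1, h2⟩ := hdir (R'.vert 0) (R.vert 0)
  obtain ⟨i, hi⟩ := hp.exists_iterate hfin h1
  obtain ⟨j, hj⟩ := hp.exists_iterate hfin h2
  have heq : ∀ n, R'.vert (n + i) = R.vert (n + j) := fun n => by
    rw [hp.ray_vert hwf R', hp.ray_vert hwf R, Function.iterate_add_apply,
      Function.iterate_add_apply, hi, hj]
  intro S hS
  obtain ⟨C, hC⟩ := R.exists_liesIn hS
  refine ⟨C, ?_, hC⟩
  obtain ⟨N, hN⟩ := Filter.eventually_atTop.1 hC
  refine Filter.eventually_atTop.2 ⟨N + i, fun n hn => ?_⟩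
  have h3 : n = (n - i) + i := by omega
  rw [h3, heq]
  exact hN _ (by omega)

theorem IsParentMap.map_orderIso (hp : IsParentMap p) (θ : W ≃o W) (a : W) :
    p (θ a) = θ (p a) := by
  apply le_antisymm
  · exact (hp _).2 _ (θ.lt_iff_lt.2 (hp a).1)
  · rw [← θ.le_symm_apply]
    exact (hp a).2 _ (θ.lt_symm_apply.2 (hp _).1)

/-- An order automorphism acts on the graph of the parent map. -/
def IsParentMap.iso (hp : IsParentMap p) (θ : W ≃o W) : parentGraph p ≃g parentGraph p where
  toEquiv := θ.toEquiv
  map_rel_iff' {a b} := by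
    change (parentGraph p).Adj (θ a) (θ b) ↔ _
    rw [hp.adj_iff, hp.adj_iff, hp.map_orderIso, hp.map_orderIso, θ.injective.eq_iff,
      θ.injective.eq_iff]

/-- The elements correspond to the edges of the tree: each to the edge to its parent. -/
theorem IsParentMap.bijective_edge (hp : IsParentMap p) :
    Function.Bijective fun a => (⟨s(a, p a), hp.adj_iff.2 (Or.inl rfl)⟩ :
      (parentGraph p).edgeSet) := by
  constructor
  · intro a b hab
    rcases Sym2.eq_iff.1 (congrArg Subtype.val hab) with h | h
    · exact h.1
    · have h1 := (hp a).1
      have h2 := (hp b).1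
      rw [h.2] at h1
      rw [← h.1] at h2
      exact absurd h1 h2.not_gt
  · rintro ⟨e, he⟩
    induction e using Sym2.ind with
    | _ a b =>
    rcases hp.adj_iff.1 (mem_edgeSet _ |>.1 he) with h | h
    · exact ⟨a, by subst h; rfl⟩
    · exact ⟨b, by
        subst h
        exact Subtype.ext Sym2.eq_swap⟩

end Parent

/-! ### From regions to relevant separations -/

/-- The separation `(clos K, Kᶜ)` of a region `K` is relevant. -/
theorem Region.isRelevant {ω : G.RayEnd} (hone : ∀ η : G.RayEnd, η = ω)
    (hk : ω.vertexDegree = k) {K : Set V} (hK : G.Region k K) :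
    IsRelevant ω (G.clos K, Kᶜ) := by
  have hdiff : G.clos K \ Kᶜ = K := by
    rw [Set.sdiff_compl, Set.inter_eq_right]
    exact subset_clos K
  refine ⟨hK.endSep.toFinSep.isSeparation, ?_, ?_, ?_, ?_, ?_⟩
  · rw [sepOrder, clos_inter_compl, hk, ← hK.finite_bdry.cast_ncard_eq, hK.ncard_bdry]
  · change (G.induce (G.clos K \ Kᶜ)).Connected
    rw [hdiff]
    exact hK.isConn.induce_connected
  · change ∀ v ∈ G.clos K ∩ Kᶜ, ∃ w ∈ G.clos K \ Kᶜ, G.Adj v w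
    rw [hdiff, clos_inter_compl]
    rintro v ⟨-, w, hw, hwv⟩
    exact ⟨w, hw, hwv.symm⟩
  · exact (RayEnd.liesIn_iff_carries hone).2 hK.carries
  · rintro ⟨⟨A, B⟩, h1, h2, h3, h4⟩
    have hf : (A ∩ B).Finite := Set.finite_of_encard_le_coe (k := k) (hk ▸ h2.le)
    rw [sepOrder, hk, ← hf.cast_ncard_eq, Nat.cast_lt] at h2
    exact h2.not_ge (hK.linked A B ⟨h1.finSep hf, (RayEnd.liesIn_iff_carries hone).1 h4⟩ h3)

theorem Region.sepNested {K L : Set V} (hK : G.Region k K) (hL : G.Region k L)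
    (h : ¬ G.Cross K L) : SepNested (G.clos K, Kᶜ) (G.clos L, Lᶜ) := by
  rcases hK.nested hL h with h | h | h
  · exact Or.inl ⟨clos_mono h, Set.compl_subset_compl.2 h⟩
  · exact Or.inr (Or.inr (Or.inr ⟨Set.compl_subset_compl.2 h, clos_mono h⟩))
  · refine Or.inr (Or.inl ⟨?_, ?_⟩)
    · exact fun v hv hvL => Set.eq_empty_iff_forall_notMem.1 (clos_inter_eq_empty h) v ⟨hv, hvL⟩
    · exact fun v hv hvK => Set.eq_empty_iff_forall_notMem.1 h v ⟨hvK, hv⟩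

theorem sepMap_clos (φ : G ≃g G) (K : Set V) :
    sepMap φ (G.clos K, Kᶜ) = (G.clos (φ '' K), (φ '' K)ᶜ) := by
  rw [sepMap, image_clos, ← image_compl_iso]

/-- The action of an automorphism on an invariant family of sets, as an order automorphism. -/
def actOn (S : Set (Set V)) (hinv : ∀ φ : G ≃g G, ∀ s ∈ S, φ '' s ∈ S) (φ : G ≃g G) :
    S ≃o S where
  toFun s := ⟨φ '' s, hinv φ s s.2⟩
  invFun s := ⟨(φ⁻¹ : G ≃g G) '' s, hinv φ⁻¹ s s.2⟩
  left_inv s := Subtype.ext (image_inv_image φ s)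
  right_inv s := Subtype.ext (image_image_inv φ s)
  map_rel_iff' := Set.image_subset_image_iff φ.injective

end SimpleGraph

open SimpleGraph in
theorem mainTheorem2 {V : Type u} (G : SimpleGraph V) (hconn : G.Connected)
    (ω : G.RayEnd) (hone : ∀ η : G.RayEnd, η = ω)
    (hundom : ∀ v : V, ¬ SimpleGraph.Dominates v ω)
    (k : ℕ) (hk : ω.vertexDegree = k) :
    ∃ S : Set (Set V × Set V),
      (∀ s ∈ S, SimpleGraph.IsRelevant ω s) ∧
      (∀ s ∈ S, ∀ t ∈ S, SimpleGraph.SepNested s t) ∧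
      ∃ hinv : ∀ φ : G ≃g G, ∀ s ∈ S, SimpleGraph.sepMap φ s ∈ S,
        ∃ (W : Type u) (T : SimpleGraph W), T.IsTree ∧ T.IsOneEnded ∧
          ∃ (f : S ≃ T.edgeSet) (ρ : (G ≃g G) →* (T ≃g T)),
            ∀ (φ : G ≃g G) (s : S),
              f ⟨SimpleGraph.sepMap φ s, hinv φ s s.2⟩ = (ρ φ).mapEdgeSet (f s) := by
  have hG := thinEnd_of_end hconn hone hundom hk
  obtain ⟨S, hS, hinv, hn, hcof⟩ := hG.exists_nested_family
  -- Inclusion makes `S` a directed poset with finite intervals, in which the elements above a given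
  -- one form a chain, so that it has a parent map.
  have hupper : ∀ F : Set (Set V), F.Finite → (∀ K ∈ F, G.Region k K) → ∀ X : Set V, X.Finite →
      ∃ s : S, X ⊆ s ∧ ∀ K ∈ F, K ⊆ s := by
    intro F hF hFr X hX
    obtain ⟨J, h1, h2, h3⟩ := hG.exists_region_of_finite hF hFr hX
    obtain ⟨s, hs, hJs⟩ := hcof J h1
    exact ⟨⟨s, hs⟩, h2.trans hJs, fun K hK => (h3 K hK).trans hJs⟩
  have hchain : ∀ a b c : S, a ≤ b → a ≤ c → b ≤ c ∨ c ≤ b := by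
    intro a b c hab hac
    rcases (hS b b.2).nested (hS c c.2) (hn b b.2 c c.2) with h | h | h
    · exact Or.inl h
    · exact Or.inr h
    · obtain ⟨x, hx⟩ := (hS a a.2).isConn.1
      exact absurd ⟨hab hx, Or.inl (hac hx)⟩ (Set.eq_empty_iff_forall_notMem.1 h x)
  have hfin : ∀ a b : S, (Set.Icc a b).Finite := by
    intro a b
    by_cases hab : a ≤ b
    · refine Set.Finite.of_finite_image (((hS b b.2).finite_between hG (hS a a.2).isConn.1
        hab).subset ?_) Subtype.val_injective.injOn
      rintro _ ⟨c, ⟨h1, h2⟩, rfl⟩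
      exact ⟨hS c c.2, h1, h2⟩
    · rw [Set.Icc_eq_empty hab]
      exact Set.finite_empty
  have hdir : ∀ a b : S, ∃ c, a ≤ c ∧ b ≤ c := by
    intro a b
    obtain ⟨c, -, hc⟩ := hupper {a.1, b.1} (by simp) (by
      rintro K (rfl | rfl)
      · exact hS _ a.2
      · exact hS _ b.2) ∅ Set.finite_empty
    exact ⟨c, hc _ (Or.inl rfl), hc _ (Or.inr rfl)⟩
  have hup : ∀ a : S, ∃ b, a < b := by
    intro a
    obtain ⟨R⟩ := hG.exists_ray
    obtain ⟨n, hv⟩ := ((hS a a.2).carries R).exists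
    obtain ⟨c, h1, h2⟩ := hupper {a.1} (by simp) (by
      rintro K rfl
      exact hS _ a.2) {R.vert n} (Set.finite_singleton _)
    exact ⟨c, h2 _ rfl, fun h => hv (h (h1 rfl))⟩
  have hwf : ∀ f : ℕ → S, ¬ ∀ n, f (n + 1) < f n := fun f hf =>
    hG.not_descending (fun n => (f n).1) (fun n => hS _ (f n).2) hf
  have hne : Nonempty S := by
    obtain ⟨s, -⟩ := hupper ∅ Set.finite_empty (by simp) ∅ Set.finite_empty
    exact ⟨s⟩
  obtain ⟨p, hp⟩ := exists_isParentMap hchain hfin hup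
  let g : S → ((fun K => (G.clos K, Kᶜ)) '' S : Set (Set V × Set V)) := fun K => ⟨_, K, K.2, rfl⟩
  have hg : Function.Bijective g := by
    constructor
    · intro a b hab
      have : (a.1)ᶜ = (b.1)ᶜ := congrArg (fun x => x.1.2) hab
      exact Subtype.ext (compl_injective this)
    · rintro ⟨_, K, hK, rfl⟩
      exact ⟨⟨K, hK⟩, rfl⟩
  -- A separation in the family corresponds to a member of `S`, and this to the edge to its parent.
  let e := Equiv.ofBijective _ hp.bijective_edge
  refine ⟨(fun K => (G.clos K, Kᶜ)) '' S, ?_, ?_, ?_, S, parentGraph p, hp.isTree hfin hdir,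
    hp.isOneEnded hfin hdir hwf, (Equiv.ofBijective g hg).symm.trans e,
    ⟨⟨fun φ => hp.iso (actOn S hinv φ), ?_⟩, ?_⟩, ?_⟩
  · rintro _ ⟨K, hK, rfl⟩
    exact (hS K hK).isRelevant hone hk
  · rintro _ ⟨K, hK, rfl⟩ _ ⟨L, hL, rfl⟩
    exact (hS K hK).sepNested (hS L hL) (hn K hK L hL)
  · rintro φ _ ⟨K, hK, rfl⟩
    exact ⟨φ '' K, hinv φ K hK, (sepMap_clos φ K).symm⟩
  · exact RelIso.ext fun s => Subtype.ext (image_one s.1)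
  · exact fun φ ψ => RelIso.ext fun s => Subtype.ext (image_mul φ ψ s.1)
  · intro φ s
    obtain ⟨a, rfl⟩ := hg.2 s
    have h1 : ∀ h, (⟨sepMap φ (g a).1, h⟩ : ((fun K => (G.clos K, Kᶜ)) '' S : Set _)) =
        g (actOn S hinv φ a) := fun _ => Subtype.ext (sepMap_clos φ a.1)
    have h2 : ∀ b, (Equiv.ofBijective g hg).symm (g b) = b :=
      (Equiv.ofBijective g hg).symm_apply_apply
    rw [h1, Equiv.trans_apply, Equiv.trans_apply, h2, h2]
    apply Subtype.ext
    change s(actOn S hinv φ a, p (actOn S hinv φ a)) = _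
    rw [hp.map_orderIso]
    rfl
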